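/- All modules are left modules. For a ring $R$, let $\mathrm{spli}(R)$ (respectively $\mathrm{sfli}(R)$) be the supremum of the projective dimensions (respectively flat dimensions) of all injective $R$-modules, with value $\infty$ allowed. For a commutative ring $A$ and a group $G$, let $AG$ be the group ring. A group is locally finite if all its finitely generated subgroups are finite. We say that $A$ satisfies - the $(\mathrm{spli},\mathrm{finite})$ principle if every group $G$ with $\mathrm{spli}(AG)=\mathrm{spli}(A)$ is finite; - the $(\mathrm{sfli},\mathrm{locally\ finite})$ principle if every group $G$ with $\mathrm{sfli}(AG)=\mathrm{sfli}(A)$ is locally finite; - the $(\mathrm{spli},\mathrm{locally\ finite})$ principle if every group $G$ with $\mathrm{spli}(AG)=\mathrm{spli}(A)$ is locally finite. Let $A$ be a Noetherian commutative ring. If $A$ satisfies the $(\mathrm{spli},\mathrm{finite})$ principle, then $A$ satisfies the $(\mathrm{sfli},\mathrm{locally\ finite})$ principle. If $A$ satisfies the $(\mathrm{sfli},\mathrm{locally\ finite})$ principle, then $A$ satisfies the $(\mathrm{spli},\mathrm{locally\ finite})$ principle. -/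

import Mathlib

open scoped TensorProduct

universe u

namespace GroupAlgebraDim

/-! ### Flat modules and flat dimension over a not necessarily commutative ring

A right `R`-module is a module over `Rᵐᵒᵖ`. -/

section Tensor

variable (R : Type u) [Ring R]

/-- The subgroup of `N ⊗[ℤ] M` generated by the elements `(n · r) ⊗ m - n ⊗ (r · m)`, for a right
`R`-module `N` and a left `R`-module `M`. -/
def balancing (N M : Type u) [AddCommGroup N] [Module Rᵐᵒᵖ N] [AddCommGroup M] [Module R M] :
    AddSubgroup (N ⊗[ℤ] M) :=
  AddSubgroup.closure
    {t | ∃ (n : N) (r : R) (m : M), t = (MulOpposite.op r • n) ⊗ₜ[ℤ] m - n ⊗ₜ[ℤ] (r • m)}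

/-- The tensor product `N ⊗_R M` of a right `R`-module `N` and a left `R`-module `M`,
an abelian group. -/
abbrev BalancedTensor (N M : Type u) [AddCommGroup N] [Module Rᵐᵒᵖ N] [AddCommGroup M]
    [Module R M] : Type u :=
  (N ⊗[ℤ] M) ⧸ balancing R N M

variable {N N' : Type u} [AddCommGroup N] [Module Rᵐᵒᵖ N] [AddCommGroup N'] [Module Rᵐᵒᵖ N']

theorem balancing_le_comap (f : N →ₗ[Rᵐᵒᵖ] N') (M : Type u) [AddCommGroup M] [Module R M] :
    balancing R N M ≤
      (balancing R N' M).comap (f.toAddMonoidHom.toIntLinearMap.rTensor M).toAddMonoidHom := by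
  refine (AddSubgroup.closure_le _).2 ?_
  rintro _ ⟨n, r, m, rfl⟩
  refine AddSubgroup.subset_closure ⟨f n, r, m, ?_⟩
  simp

/-- The map `f ⊗ id_M : N ⊗_R M → N' ⊗_R M` induced by a homomorphism `f : N → N'` of right
`R`-modules. -/
def balancedMap (f : N →ₗ[Rᵐᵒᵖ] N') (M : Type u) [AddCommGroup M] [Module R M] :
    BalancedTensor R N M →+ BalancedTensor R N' M :=
  QuotientAddGroup.map _ _ (f.toAddMonoidHom.toIntLinearMap.rTensor M).toAddMonoidHom
    (balancing_le_comap R f M)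

/-- A left `R`-module `M` is flat if `- ⊗_R M` preserves injectivity of homomorphisms of right
`R`-modules. -/
def IsFlat (M : Type u) [AddCommGroup M] [Module R M] : Prop :=
  ∀ (N N' : Type u) [AddCommGroup N] [Module Rᵐᵒᵖ N] [AddCommGroup N'] [Module Rᵐᵒᵖ N']
    (f : N →ₗ[Rᵐᵒᵖ] N'), Function.Injective f → Function.Injective (balancedMap R f M)

/-- `M` has a resolution `0 → F_n → ⋯ → F_0 → M → 0` by flat left `R`-modules. The resolution is
given step by step: `F_0 → M` is surjective and its kernel has such a resolution of length
`n - 1`. -/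
def FlatDimLE : ℕ → ∀ (M : Type u) [AddCommGroup M] [Module R M], Prop
  | 0, M, _, _ => IsFlat R M
  | n + 1, M, _, _ =>
      ∃ (F : Type u) (_ : AddCommGroup F) (_ : Module R F) (p : F →ₗ[R] M),
        IsFlat R F ∧ Function.Surjective p ∧ FlatDimLE n (LinearMap.ker p)

/-- The flat dimension of a left `R`-module: the least length of a flat resolution, `⊤` if there is
no finite one. -/
noncomputable def flatDim (M : Type u) [AddCommGroup M] [Module R M] : ℕ∞ :=
  ⨅ (n : ℕ) (_ : FlatDimLE R n M), (n : ℕ∞)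

end Tensor

/-! ### The invariants `spli` and `sfli` -/

/-- The supremum of the projective dimensions of the injective left `R`-modules. -/
noncomputable def spli (R : Type u) [Ring R] : WithBot ℕ∞ :=
  ⨆ (I : ModuleCat.{u} R) (_ : Module.Injective R I), CategoryTheory.projectiveDimension I

/-- The supremum of the flat dimensions of the injective left `R`-modules. -/
noncomputable def sfli (R : Type u) [Ring R] : ℕ∞ :=
  ⨆ (I : ModuleCat.{u} R) (_ : Module.Injective R I), flatDim R I

/-! ### The principles -/

/-- A group is locally finite if each of its finitely generated subgroups is finite. -/
def IsLocallyFinite (G : Type u) [Group G] : Prop :=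
  ∀ H : Subgroup G, H.FG → Finite H

/-- For every group `G`, if `spli (AG) = spli A`, then `G` is finite. -/
def SpliFinitePrinciple (A : Type u) [CommRing A] : Prop :=
  ∀ (G : Type u) [Group G], spli (MonoidAlgebra A G) = spli A → Finite G

/-- For every group `G`, if `sfli (AG) = sfli A`, then `G` is locally finite. -/
def SfliLocallyFinitePrinciple (A : Type u) [CommRing A] : Prop :=
  ∀ (G : Type u) [Group G], sfli (MonoidAlgebra A G) = sfli A → IsLocallyFinite G

/-- For every group `G`, if `spli (AG) = spli A`, then `G` is locally finite. -/
def SpliLocallyFinitePrinciple (A : Type u) [CommRing A] : Prop :=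
  ∀ (G : Type u) [Group G], spli (MonoidAlgebra A G) = spli A → IsLocallyFinite G

end GroupAlgebraDim

/-! The core is unconditional: if `A` is nontrivial and Noetherian with `sfli A = n` finite, then
`sfli (AG) ≤ n` already forces `G` to be locally finite (`isLocallyFinite_of_sfli_le`). The assumed
principle is applied only to `ℤ`, to make `A` nontrivial and `sfli A` finite: over the zero ring, or
if `sfli A = ⊤`, the invariants of `A` and `Aℤ` agree, which the principle forbids
(`nontrivial_and_exists_sfli_eq`). For the conclusion about `spli`, a Noetherian `A` satisfies `spli
A ≤ n` as soon as `sfli A ≤ n` (`spli_le_of_sfli_le`), so `sfli (AG) ≤ spli (AG) = spli A ≤ n`.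

For `n = 0`, the module `Hom_A(AG, (A_p)⁺)`, where `⁺` denotes characters in `ℚ/ℤ`, is injective and
contains a nonzero `G`-fixed element. If it is flat, no finitely generated subgroup `H` is infinite:
no nonzero `b` in `AG` satisfies `(t - 1) b = 0` for all generators `t` of an infinite `H`, and
flatness turns this into the vanishing of fixed elements (`HasFixed.isLocallyFinite`).

For `n > 0`, some `A`-module has flat dimension exactly `n`, which gives a nonzero Tor at a prime
`p`. As in the theory of depth, this obstruction yields an element `x` of `p` regular on the local
ring (`TorWitness.exists_regularMod`). Reduction modulo `x` preserves the obstruction, while passing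
to `x`-torsion lowers the flat dimension of the injective `AG`-module by one and keeps the fixed
element (`res_ker_cmul`). After `n` rounds that module is flat relative to the accumulated ideal.

Rings are never changed in the descent. Quotients by `I` and localizations at `S` are encoded by
modules killed by `I` on which `S` acts bijectively, and flatness by relative injectivity of the
character module. -/

namespace GroupAlgebraDim

/-! ### Linear algebra preliminaries -/

section Lifting

variable {R : Type u} [Ring R] {X Y Z : Type u} [AddCommGroup X] [Module R X]
  [AddCommGroup Y] [Module R Y] [AddCommGroup Z] [Module R Z]

theorem exists_factor_of_surjective (q : X →ₗ[R] Y) (hq : Function.Surjective q) (h : X →ₗ[R] Z)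
    (hk : ∀ x, q x = 0 → h x = 0) : ∃ h' : Y →ₗ[R] Z, ∀ x, h' (q x) = h x := by
  refine ⟨((LinearMap.ker q).liftQ h (fun x hx => hk x hx)) ∘ₗ
    (q.quotKerEquivOfSurjective hq).symm.toLinearMap, fun x => ?_⟩
  have : (q.quotKerEquivOfSurjective hq).symm (q x) = (LinearMap.ker q).mkQ x := by
    rw [LinearEquiv.symm_apply_eq]; rfl
  rw [LinearMap.comp_apply, LinearEquiv.coe_coe, this]
  rfl

theorem exists_factor_of_injective (j : Y →ₗ[R] Z) (hj : Function.Injective j) (h : X →ₗ[R] Z)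
    (hk : ∀ x, ∃ y, j y = h x) : ∃ h' : X →ₗ[R] Y, ∀ x, j (h' x) = h x := by
  refine ⟨(LinearEquiv.ofInjective j hj).symm.toLinearMap ∘ₗ
    h.codRestrict (LinearMap.range j) (fun x => hk x), fun x => ?_⟩
  have := LinearEquiv.apply_symm_apply (LinearEquiv.ofInjective j hj)
    (h.codRestrict (LinearMap.range j) (fun x => hk x) x)
  exact congrArg Subtype.val this

end Lifting

theorem exists_addChar_extension {X Y : Type u} [AddCommGroup X] [AddCommGroup Y] (i : X →+ Y)
    (hi : Function.Injective i) (c : X →+ AddCircle (1 : ℚ)) :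
    ∃ c' : Y →+ AddCircle (1 : ℚ), ∀ x, c' (i x) = c x := by
  obtain ⟨c', hc'⟩ := CharacterModule.dual_surjective_of_injective (R := ℤ) i.toIntLinearMap hi c
  exact ⟨c', fun x => DFunLike.congr_fun hc' x⟩

theorem eq_zero_of_addChar {X : Type u} [AddCommGroup X] {x : X}
    (h : ∀ c : X →+ AddCircle (1 : ℚ), c x = 0) : x = 0 :=
  CharacterModule.eq_zero_of_character_apply (fun c => h c)

/-- Characters of `X ⧸ T` separate points. This converts extension properties of character modules
into membership in submodules. -/
theorem mem_of_addChar {X : Type u} [AddCommGroup X] {T : AddSubgroup X} {x : X}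
    (h : ∀ c : X →+ AddCircle (1 : ℚ), (∀ t ∈ T, c t = 0) → c x = 0) : x ∈ T := by
  rw [← QuotientAddGroup.eq_zero_iff]
  refine eq_zero_of_addChar (fun c => ?_)
  exact h (c.comp (QuotientAddGroup.mk' T)) (fun t ht => by
    have : (QuotientAddGroup.mk' T) t = 0 := (QuotientAddGroup.eq_zero_iff t).2 ht
    rw [AddMonoidHom.comp_apply, this, map_zero])

/-! ### Character modules over a noncommutative ring -/

section Char

variable (B : Type u) [Ring B]

/-- The character group of a left `B`-module, as a right `B`-module. -/
def RChar (M : Type u) [AddCommGroup M] [Module B M] : Type u := M →+ AddCircle (1 : ℚ)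

/-- The character group of a right `B`-module, as a left `B`-module. -/
def LChar (Y : Type u) [AddCommGroup Y] [Module Bᵐᵒᵖ Y] : Type u := Y →+ AddCircle (1 : ℚ)

section

variable (M : Type u) [AddCommGroup M] [Module B M]

instance : AddCommGroup (RChar B M) := inferInstanceAs (AddCommGroup (M →+ AddCircle (1 : ℚ)))

instance : FunLike (RChar B M) M (AddCircle (1 : ℚ)) :=
  inferInstanceAs (FunLike (M →+ AddCircle (1 : ℚ)) M (AddCircle (1 : ℚ)))

instance : AddMonoidHomClass (RChar B M) M (AddCircle (1 : ℚ)) :=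
  inferInstanceAs (AddMonoidHomClass (M →+ AddCircle (1 : ℚ)) M (AddCircle (1 : ℚ)))

variable {B M}

@[ext] theorem RChar.ext {c c' : RChar B M} (h : ∀ m, c m = c' m) : c = c' := DFunLike.ext _ _ h

@[simp] theorem RChar.add_apply (c c' : RChar B M) (m : M) : (c + c') m = c m + c' m := rfl

@[simp] theorem RChar.zero_apply (m : M) : (0 : RChar B M) m = 0 := rfl

@[simp] theorem RChar.sub_apply (c c' : RChar B M) (m : M) : (c - c') m = c m - c' m := rfl

instance : SMul Bᵐᵒᵖ (RChar B M) :=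
  ⟨fun r c => (AddMonoidHom.comp (show M →+ AddCircle (1 : ℚ) from c)
    (DistribSMul.toAddMonoidHom M r.unop))⟩

@[simp] theorem RChar.smul_apply (r : Bᵐᵒᵖ) (c : RChar B M) (m : M) :
    (r • c) m = c (r.unop • m) := rfl

instance : Module Bᵐᵒᵖ (RChar B M) where
  one_smul c := by ext m; simp
  mul_smul r s c := by ext m; simp [mul_smul]
  smul_zero r := by ext m; simp
  smul_add r c c' := by ext m; simp
  add_smul r s c := by ext m; simp [add_smul]
  zero_smul c := by ext m; simp

end

section

variable (Y : Type u) [AddCommGroup Y] [Module Bᵐᵒᵖ Y]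

instance : AddCommGroup (LChar B Y) := inferInstanceAs (AddCommGroup (Y →+ AddCircle (1 : ℚ)))

instance : FunLike (LChar B Y) Y (AddCircle (1 : ℚ)) :=
  inferInstanceAs (FunLike (Y →+ AddCircle (1 : ℚ)) Y (AddCircle (1 : ℚ)))

instance : AddMonoidHomClass (LChar B Y) Y (AddCircle (1 : ℚ)) :=
  inferInstanceAs (AddMonoidHomClass (Y →+ AddCircle (1 : ℚ)) Y (AddCircle (1 : ℚ)))

variable {B Y}

@[ext] theorem LChar.ext {c c' : LChar B Y} (h : ∀ m, c m = c' m) : c = c' := DFunLike.ext _ _ h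

@[simp] theorem LChar.add_apply (c c' : LChar B Y) (m : Y) : (c + c') m = c m + c' m := rfl

@[simp] theorem LChar.zero_apply (m : Y) : (0 : LChar B Y) m = 0 := rfl

instance : SMul B (LChar B Y) :=
  ⟨fun r c => (AddMonoidHom.comp (show Y →+ AddCircle (1 : ℚ) from c)
    (DistribSMul.toAddMonoidHom Y (MulOpposite.op r)))⟩

@[simp] theorem LChar.smul_apply (r : B) (c : LChar B Y) (m : Y) :
    (r • c) m = c (MulOpposite.op r • m) := rfl

instance : Module B (LChar B Y) where
  one_smul c := by ext m; simp
  mul_smul r s c := by ext m; simp [mul_smul]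
  smul_zero r := by ext m; simp
  smul_add r c c' := by ext m; simp
  add_smul r s c := by ext m; simp [add_smul]
  zero_smul c := by ext m; simp

end

variable {B} {M N Y Y' : Type u} [AddCommGroup M] [Module B M] [AddCommGroup N] [Module B N]
  [AddCommGroup Y] [Module Bᵐᵒᵖ Y] [AddCommGroup Y'] [Module Bᵐᵒᵖ Y']

/-- Precomposition of characters with a homomorphism of left modules. -/
def RChar.map (f : M →ₗ[B] N) : RChar B N →ₗ[Bᵐᵒᵖ] RChar B M where
  toFun c := AddMonoidHom.comp (show N →+ AddCircle (1 : ℚ) from c) f.toAddMonoidHom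
  map_add' c c' := rfl
  map_smul' r c := by
    ext m
    exact congrArg c (f.map_smul r.unop m).symm

@[simp] theorem RChar.map_apply (f : M →ₗ[B] N) (c : RChar B N) (m : M) :
    RChar.map f c m = c (f m) := rfl

/-- Precomposition of characters with a homomorphism of right modules. -/
def LChar.map (f : Y →ₗ[Bᵐᵒᵖ] Y') : LChar B Y' →ₗ[B] LChar B Y where
  toFun c := AddMonoidHom.comp (show Y' →+ AddCircle (1 : ℚ) from c) f.toAddMonoidHom
  map_add' c c' := rfl
  map_smul' r c := by
    ext m
    exact congrArg c (f.map_smul (MulOpposite.op r) m).symm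

@[simp] theorem LChar.map_apply (f : Y →ₗ[Bᵐᵒᵖ] Y') (c : LChar B Y') (m : Y) :
    LChar.map f c m = c (f m) := rfl

/-- Exchange the two arguments of a balanced pairing. -/
def toLChar (g : Y →ₗ[Bᵐᵒᵖ] RChar B M) : M →ₗ[B] LChar B Y where
  toFun m := (⟨⟨fun y => g y m, by simp⟩, fun y y' => by simp⟩ : Y →+ AddCircle (1 : ℚ))
  map_add' m m' := by ext y; exact map_add (g y) m m'
  map_smul' r m := by
    ext y
    change g y (r • m) = g (MulOpposite.op r • y) m
    simp

@[simp] theorem toLChar_apply (g : Y →ₗ[Bᵐᵒᵖ] RChar B M) (m : M) (y : Y) :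
    toLChar g m y = g y m := rfl

/-- Exchange the two arguments of a balanced pairing. -/
def toRChar (g : M →ₗ[B] LChar B Y) : Y →ₗ[Bᵐᵒᵖ] RChar B M where
  toFun y := (⟨⟨fun m => g m y, by simp⟩, fun y y' => by simp⟩ : M →+ AddCircle (1 : ℚ))
  map_add' m m' := by ext y; exact map_add (g y) m m'
  map_smul' r m := by
    ext y
    change g y (r • m) = g (r.unop • y) m
    simp

theorem RChar.map_surjective (f : M →ₗ[B] N) (hf : Function.Injective f) :
    Function.Surjective (RChar.map f) := fun c => by
  obtain ⟨c', hc'⟩ := exists_addChar_extension f.toAddMonoidHom hf c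
  exact ⟨c', RChar.ext hc'⟩

theorem LChar.map_surjective (f : Y →ₗ[Bᵐᵒᵖ] Y') (hf : Function.Injective f) :
    Function.Surjective (LChar.map f) := fun c => by
  obtain ⟨c', hc'⟩ := exists_addChar_extension f.toAddMonoidHom hf c
  exact ⟨c', LChar.ext hc'⟩

theorem RChar.map_injective (f : M →ₗ[B] N) (hf : Function.Surjective f) :
    Function.Injective (RChar.map f) := fun c c' h => by
  ext n
  obtain ⟨m, rfl⟩ := hf n
  exact DFunLike.congr_fun h m

theorem RChar.exists_map_eq (f : M →ₗ[B] N) (hf : Function.Surjective f) (c : RChar B M)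
    (hc : ∀ m, f m = 0 → c m = 0) : ∃ c', RChar.map f c' = c := by
  let e := QuotientAddGroup.quotientKerEquivOfSurjective f.toAddMonoidHom hf
  let c₀ : M ⧸ f.toAddMonoidHom.ker →+ AddCircle (1 : ℚ) :=
    QuotientAddGroup.lift _ (show M →+ AddCircle (1 : ℚ) from c) (fun m hm => hc m hm)
  refine ⟨c₀.comp e.symm.toAddMonoidHom, RChar.ext fun m => ?_⟩
  have : e.symm (f m) = QuotientAddGroup.mk m := by
    rw [AddEquiv.symm_apply_eq]; rfl
  change c₀ (e.symm (f m)) = c m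
  rw [this]; rfl

end Char

/-! ### Relative injectivity and flatness -/

section Relative

variable {A : Type u} [CommRing A] (B : Type u) [Ring B] [Algebra A B]

/-- The ideal `I` annihilates `M`. -/
def Killed (I : Ideal A) (M : Type u) [AddCommGroup M] [Module B M] : Prop :=
  ∀ a ∈ I, ∀ m : M, algebraMap A B a • m = 0

/-- The elements of `S` act bijectively on `M`. -/
def SLoc (S : Submonoid A) (M : Type u) [AddCommGroup M] [Module B M] : Prop :=
  ∀ s ∈ S, Function.Bijective (fun m : M => algebraMap A B s • m)

/-- Injectivity relative to modules annihilated by `I`. -/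
def RInj (I : Ideal A) (E : Type u) [AddCommGroup E] [Module B E] : Prop :=
  ∀ (X X' : Type u) [AddCommGroup X] [Module B X] [AddCommGroup X'] [Module B X']
    (i : X →ₗ[B] X'), Function.Injective i → Killed B I X → Killed B I X' →
    ∀ g : X →ₗ[B] E, ∃ g' : X' →ₗ[B] E, ∀ x, g' (i x) = g x

/-- `M` is annihilated by `I` and flat as a module over `B ⧸ I B`. -/
def RFlat (I : Ideal A) (M : Type u) [AddCommGroup M] [Module B M] : Prop :=
  Killed B I M ∧ RInj Bᵐᵒᵖ I (RChar B M)

variable {B} {I : Ideal A} {S : Submonoid A}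
  {M N : Type u} [AddCommGroup M] [Module B M] [AddCommGroup N] [Module B N]

theorem algebraMap_smul_comm (a : A) (b : B) (m : M) :
    algebraMap A B a • b • m = b • algebraMap A B a • m := by
  rw [← mul_smul, ← mul_smul, Algebra.commutes]

theorem Killed.of_injective (h : Killed B I N) (f : M →ₗ[B] N) (hf : Function.Injective f) :
    Killed B I M := fun a ha m => hf (by rw [f.map_smul, h a ha, map_zero])

theorem Killed.of_surjective (h : Killed B I M) (f : M →ₗ[B] N) (hf : Function.Surjective f) :
    Killed B I N := fun a ha n => by
  obtain ⟨m, rfl⟩ := hf n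
  rw [← f.map_smul, h a ha, map_zero]

theorem Killed.mono {J : Ideal A} (h : Killed B J M) (hIJ : I ≤ J) : Killed B I M :=
  fun a ha => h a (hIJ ha)

theorem killed_bot : Killed B (⊥ : Ideal A) M := fun a ha m => by
  rw [Ideal.mem_bot.1 ha, map_zero, zero_smul]

theorem Killed.rChar (h : Killed B I M) : Killed Bᵐᵒᵖ I (RChar B M) := fun a ha c => by
  ext m
  simp [MulOpposite.algebraMap_apply, h a ha m]

theorem SLoc.equiv (h : SLoc B S M) (e : M ≃ₗ[B] N) : SLoc B S N := fun s hs => by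
  have : (fun n : N => algebraMap A B s • n) = e ∘ (fun m : M => algebraMap A B s • m) ∘ e.symm := by
    ext n; simp
  rw [this]
  exact e.bijective.comp ((h s hs).comp e.symm.bijective)

theorem SLoc.ker (hM : SLoc B S M) (hN : SLoc B S N) (f : M →ₗ[B] N) :
    SLoc B S (LinearMap.ker f) := fun s hs => by
  refine ⟨fun x y h => Subtype.ext ((hM s hs).1 (congrArg Subtype.val h)), fun y => ?_⟩
  obtain ⟨m, hm⟩ := (hM s hs).2 y.1
  refine ⟨⟨m, (hN s hs).1 ?_⟩, Subtype.ext hm⟩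
  simp only [smul_zero]
  rw [← f.map_smul, show algebraMap A B s • m = y.1 from hm]
  exact y.2

theorem RInj.of_retract (h : RInj B I N) (s : M →ₗ[B] N) (r : N →ₗ[B] M)
    (hrs : ∀ m, r (s m) = m) : RInj B I M := fun X X' _ _ _ _ i hi hX hX' g => by
  obtain ⟨g', hg'⟩ := h X X' i hi hX hX' (s ∘ₗ g)
  exact ⟨r ∘ₗ g', fun x => by simp [hg', hrs]⟩

theorem RFlat.equiv (h : RFlat B I M) (e : M ≃ₗ[B] N) : RFlat B I N :=
  ⟨h.1.of_surjective e.toLinearMap e.surjective,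
    h.2.of_retract (RChar.map e.toLinearMap) (RChar.map e.symm.toLinearMap)
      (fun c => by ext m; simp)⟩

/-- The kernel of a surjection between flat modules is flat. -/
theorem RFlat.ker (hM : RFlat B I M) (hN : RFlat B I N) (p : M →ₗ[B] N)
    (hp : Function.Surjective p) : RFlat B I (LinearMap.ker p) := by
  refine ⟨hM.1.of_injective (LinearMap.ker p).subtype (Submodule.injective_subtype _), ?_⟩
  -- Relative injectivity of `N⁺` splits `0 → N⁺ → M⁺ → (ker p)⁺ → 0`: `r` retracts `RChar.map p`,
  -- and `1 - p⁺ r` descends to the section `σ`. So `(ker p)⁺` is a retract of `M⁺`.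
  obtain ⟨r, hr⟩ := hN.2 _ _ (RChar.map p) (RChar.map_injective p hp) hN.1.rChar hM.1.rChar
    LinearMap.id
  have hs := RChar.map_surjective (LinearMap.ker p).subtype (Submodule.injective_subtype _)
  obtain ⟨σ, hσ⟩ := exists_factor_of_surjective (RChar.map (LinearMap.ker p).subtype) hs
    (LinearMap.id - RChar.map p ∘ₗ r) (fun c hc => by
      obtain ⟨c', rfl⟩ := RChar.exists_map_eq p hp c
        (fun m hm => DFunLike.congr_fun hc (⟨m, hm⟩ : LinearMap.ker p))
      simp [hr])
  refine hM.2.of_retract σ (RChar.map (LinearMap.ker p).subtype) (fun c => ?_)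
  obtain ⟨c, rfl⟩ := hs c
  rw [hσ]
  ext m
  simp [show p m.1 = 0 from m.2]

/-- A relatively injective module receives extensions of maps from cyclic submodules. -/
theorem RInj.exists_apply_eq {E X : Type u} [AddCommGroup E] [Module B E] [AddCommGroup X]
    [Module B X] (hE : RInj B I E) (hX : Killed B I X) (x : X) (e : E)
    (h : ∀ b : B, b • x = 0 → b • e = 0) : ∃ f : X →ₗ[B] E, f x = e := by
  let T := LinearMap.toSpanSingleton B X x
  let i : (B ⧸ LinearMap.ker T) →ₗ[B] X := (LinearMap.ker T).liftQ T le_rfl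
  have hi : Function.Injective i := by
    rw [← LinearMap.ker_eq_bot]
    exact Submodule.ker_liftQ_eq_bot _ _ _ le_rfl
  let g : (B ⧸ LinearMap.ker T) →ₗ[B] E :=
    (LinearMap.ker T).liftQ (LinearMap.toSpanSingleton B E e) (fun b hb => h b hb)
  obtain ⟨f, hf⟩ := hE _ _ i hi (hX.of_injective i hi) hX g
  refine ⟨f, ?_⟩
  have h₁ : T 1 = x := one_smul B x
  have h₂ : f (T 1) = LinearMap.toSpanSingleton B E e 1 := hf (Submodule.Quotient.mk 1)
  rwa [h₁, LinearMap.toSpanSingleton_apply, one_smul] at h₂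

/-- Exchanging arguments turns the extension of `g : X → M⁺` along an injection into the lifting of
`M → X⁺` along the surjection `X'⁺ → X⁺`. -/
theorem RFlat.of_projective (h : Module.Projective B M) (hK : Killed B I M) : RFlat B I M := by
  refine ⟨hK, fun _ _ _ _ _ _ i hi _ _ g => ?_⟩
  obtain ⟨k, hk⟩ := Module.projective_lifting_property (LChar.map i) (toLChar g)
    (LChar.map_surjective i hi)
  refine ⟨toRChar k, fun x => ?_⟩
  ext m
  exact DFunLike.congr_fun (DFunLike.congr_fun hk m) x

theorem rInj_bot_iff {E : Type u} [AddCommGroup E] [Module B E] :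
    RInj B (⊥ : Ideal A) E ↔ Module.Injective B E :=
  ⟨fun h => ⟨fun X X' _ _ _ _ i hi g => h X X' i hi killed_bot killed_bot g⟩,
    fun h _ _ _ _ _ _ i hi _ _ g => h.out i hi g⟩

end Relative

/-! ### Flatness through characters of the tensor product -/

section Flat

variable {B : Type u} [Ring B] {M : Type u} [AddCommGroup M] [Module B M]

variable {Y : Type u} [AddCommGroup Y] [Module Bᵐᵒᵖ Y]

/-- The character of `Y ⊗ M` corresponding to a homomorphism from `Y` to the characters of `M`. -/
def BalancedTensor.charOfHom (g : Y →ₗ[Bᵐᵒᵖ] RChar B M) :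
    BalancedTensor B Y M →+ AddCircle (1 : ℚ) :=
  QuotientAddGroup.lift _ (TensorProduct.liftAddHom
      ((⟨⟨fun y => (show M →+ AddCircle (1 : ℚ) from g y), map_zero g⟩, map_add g⟩ :
        Y →+ M →+ AddCircle (1 : ℚ)))
      (fun r y m => by
        change g (r • y) m = g y (r • m)
        rw [map_zsmul g, map_zsmul (g y)]; rfl)) (by
    refine (AddSubgroup.closure_le _).2 ?_
    rintro _ ⟨y, r, m, rfl⟩
    rw [SetLike.mem_coe, AddMonoidHom.mem_ker, map_sub]
    change g (MulOpposite.op r • y) m - g y (r • m) = 0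
    simp)

/-- The homomorphism from `Y` to the characters of `M` corresponding to a character of `Y ⊗ M`. -/
def BalancedTensor.homOfChar (c : BalancedTensor B Y M →+ AddCircle (1 : ℚ)) :
    Y →ₗ[Bᵐᵒᵖ] RChar B M where
  toFun y := ((c.comp (QuotientAddGroup.mk' (balancing B Y M))).comp
    (TensorProduct.mk ℤ Y M y).toAddMonoidHom)
  map_add' y y' := by
    ext m
    change c (QuotientAddGroup.mk ((y + y') ⊗ₜ[ℤ] m)) = _
    rw [TensorProduct.add_tmul]
    exact map_add c (QuotientAddGroup.mk _) (QuotientAddGroup.mk _)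
  map_smul' r y := by
    ext m
    change c (QuotientAddGroup.mk ((r • y) ⊗ₜ[ℤ] m)) = c (QuotientAddGroup.mk (y ⊗ₜ[ℤ] (r.unop • m)))
    congr 1
    rw [eq_comm, QuotientAddGroup.eq]
    refine AddSubgroup.subset_closure ⟨y, r.unop, m, ?_⟩
    rw [MulOpposite.op_unop]
    abel

/-- Characters of `Y ⊗ M` are homomorphisms `Y → M⁺`. Since `ℚ/ℤ` is an injective cogenerator, `f ⊗
M` is injective exactly when all such homomorphisms extend along `f`. Tensor products are not needed
afterwards. -/
theorem isFlat_iff_injective_rChar : IsFlat B M ↔ Module.Injective Bᵐᵒᵖ (RChar B M) := by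
  constructor
  · refine fun h => ⟨fun Y Y' _ _ _ _ f hf g => ?_⟩
    obtain ⟨c', hc'⟩ := exists_addChar_extension (balancedMap B f M) (h Y Y' f hf)
      (BalancedTensor.charOfHom g)
    exact ⟨BalancedTensor.homOfChar c', fun y => RChar.ext fun m =>
      hc' (QuotientAddGroup.mk (y ⊗ₜ[ℤ] m))⟩
  · intro h Y Y' _ _ _ _ f hf
    rw [injective_iff_map_eq_zero]
    intro t ht
    refine eq_zero_of_addChar (fun c => ?_)
    obtain ⟨g, hg⟩ := h.out f hf (BalancedTensor.homOfChar c)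
    have key : ∀ t, BalancedTensor.charOfHom g (balancedMap B f M t) = c t := by
      intro t
      induction t using QuotientAddGroup.induction_on with
      | H t =>
        induction t using TensorProduct.induction_on with
        | zero =>
          exact (map_zero ((BalancedTensor.charOfHom g).comp (balancedMap B f M))).trans
            (map_zero c).symm
        | tmul y m =>
          change g (f y) m = _
          rw [hg]; rfl
        | add t₁ t₂ h₁ h₂ =>
          have e : ((t₁ + t₂ : Y ⊗[ℤ] M) : BalancedTensor B Y M) =
            (t₁ : BalancedTensor B Y M) + t₂ := rfl
          rw [e, map_add, map_add, map_add, h₁, h₂]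
    rw [← key, ht, map_zero]

theorem isFlat_iff_rFlat_bot {A : Type u} [CommRing A] [Algebra A B] :
    IsFlat B M ↔ RFlat B (⊥ : Ideal A) M := by
  rw [isFlat_iff_injective_rChar, RFlat, rInj_bot_iff]
  exact ⟨fun h => ⟨killed_bot, h⟩, fun h => h.2⟩

theorem IsFlat.of_projective (h : Module.Projective B M) : IsFlat B M :=
  (isFlat_iff_rFlat_bot (A := Subring.center B)).2 (.of_projective h killed_bot)

end Flat

/-! ### Resolutions by modules from a given class -/

section Resolutions

variable {B : Type u} [Ring B]

/-- `M` has a resolution of length `n` by modules in `𝓕` whose last syzygy satisfies `𝓠`. -/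
def Res (𝓕 𝓠 : ∀ (M : Type u) [AddCommGroup M] [Module B M], Prop) :
    ℕ → ∀ (M : Type u) [AddCommGroup M] [Module B M], Prop
  | 0, M, _, _ => 𝓠 M
  | n + 1, M, _, _ =>
      ∃ (F : Type u) (_ : AddCommGroup F) (_ : Module B F) (p : F →ₗ[B] M),
        𝓕 F ∧ Function.Surjective p ∧ Res 𝓕 𝓠 n (LinearMap.ker p)

variable {𝓕 𝓠 𝓕' 𝓠' : ∀ (M : Type u) [AddCommGroup M] [Module B M], Prop}

theorem flatDimLE_iff_res (n : ℕ) (M : Type u) [AddCommGroup M] [Module B M] :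
    FlatDimLE B n M ↔ Res (IsFlat B) (IsFlat B) n M := by
  induction n generalizing M with
  | zero => rfl
  | succ n ih => simp only [FlatDimLE, Res, ih]

theorem Res.equiv (h𝓠 : ∀ (M N : Type u) [AddCommGroup M] [Module B M] [AddCommGroup N]
      [Module B N], (M ≃ₗ[B] N) → 𝓠 M → 𝓠 N) (n : ℕ) {M N : Type u} [AddCommGroup M] [Module B M]
    [AddCommGroup N] [Module B N] (e : M ≃ₗ[B] N) (h : Res 𝓕 𝓠 n M) : Res 𝓕 𝓠 n N := by
  cases n with
  | zero => exact h𝓠 M N e h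
  | succ n =>
    obtain ⟨F, _, _, p, hF, hp, hK⟩ := h
    refine ⟨F, _, _, e.toLinearMap ∘ₗ p, hF, e.surjective.comp hp, ?_⟩
    rwa [LinearEquiv.ker_comp]

theorem Res.imp (h𝓕 : ∀ (M : Type u) [AddCommGroup M] [Module B M], 𝓕 M → 𝓕' M)
    (h𝓠 : ∀ (M : Type u) [AddCommGroup M] [Module B M], 𝓠 M → 𝓠' M) (n : ℕ) {M : Type u}
    [AddCommGroup M] [Module B M] (h : Res 𝓕 𝓠 n M) : Res 𝓕' 𝓠' n M := by
  induction n generalizing M with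
  | zero => exact h𝓠 M h
  | succ n ih =>
    obtain ⟨F, _, _, p, hF, hp, hK⟩ := h
    exact ⟨F, _, _, p, h𝓕 F hF, hp, ih hK⟩

theorem Res.exists {ι : Sort*} {𝓠 : ι → ∀ (M : Type u) [AddCommGroup M] [Module B M], Prop} (n : ℕ)
    {M : Type u} [AddCommGroup M] [Module B M] (h : Res 𝓕 (fun M _ _ => ∃ i, 𝓠 i M) n M) :
    ∃ i, Res 𝓕 (𝓠 i) n M := by
  induction n generalizing M with
  | zero => exact h
  | succ n ih =>
    obtain ⟨F, _, _, p, hF, hp, hK⟩ := h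
    obtain ⟨i, hi⟩ := ih hK
    exact ⟨i, F, _, _, p, hF, hp, hi⟩

/-- If `𝓕` is closed under kernels of surjections, then so is the class of modules with an
`𝓕`-resolution of length `n`, as long as the target is in `𝓕`. -/
theorem Res.ker (he : ∀ (M N : Type u) [AddCommGroup M] [Module B M] [AddCommGroup N]
      [Module B N], (M ≃ₗ[B] N) → 𝓕 M → 𝓕 N)
    (hk : ∀ (M N : Type u) [AddCommGroup M] [Module B M] [AddCommGroup N] [Module B N]
      (p : M →ₗ[B] N), Function.Surjective p → 𝓕 M → 𝓕 N → 𝓕 (LinearMap.ker p))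
    (n : ℕ) {M N : Type u} [AddCommGroup M] [Module B M]
    [AddCommGroup N] [Module B N] (p : M →ₗ[B] N) (hp : Function.Surjective p)
    (hM : Res 𝓕 𝓕 n M) (hN : 𝓕 N) : Res 𝓕 𝓕 n (LinearMap.ker p) := by
  cases n with
  | zero => exact hk M N p hp hM hN
  | succ n =>
    obtain ⟨F, _, _, π, hF, hπ, hK⟩ := hM
    -- The sequence `0 → ker π → ker (p ∘ π) → ker p → 0` is exact, and its middle term is in `𝓕` as
    -- the kernel of a surjection from `F` onto `N`.
    let ρ : LinearMap.ker (p ∘ₗ π) →ₗ[B] LinearMap.ker p :=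
      π.restrict (p := LinearMap.ker (p ∘ₗ π)) (q := LinearMap.ker p) (fun x hx => hx)
    refine ⟨LinearMap.ker (p ∘ₗ π), _, _, ρ, hk _ _ _ (hp.comp hπ) hF hN, ?_, ?_⟩
    · rintro ⟨m, hm⟩
      obtain ⟨f, rfl⟩ := hπ m
      exact ⟨⟨f, hm⟩, rfl⟩
    · let e : LinearMap.ker π ≃ₗ[B] LinearMap.ker ρ :=
        { toFun := fun f => ⟨⟨f.1, by
            rw [LinearMap.mem_ker, LinearMap.comp_apply, show π f.1 = 0 from f.2, map_zero]⟩,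
              Subtype.ext f.2⟩
          map_add' := fun _ _ => rfl
          map_smul' := fun _ _ => rfl
          invFun := fun f => ⟨f.1.1, congrArg Subtype.val f.2⟩
          left_inv := fun _ => rfl
          right_inv := fun _ => rfl }
      exact hK.equiv he n e

theorem Res.succ
    (hk : ∀ (M N : Type u) [AddCommGroup M] [Module B M] [AddCommGroup N] [Module B N]
      (p : M →ₗ[B] N), Function.Surjective p → 𝓕 M → 𝓕 N → 𝓕 (LinearMap.ker p))
    (n : ℕ) {M : Type u} [AddCommGroup M] [Module B M] (hM : Res 𝓕 𝓕 n M) :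
    Res 𝓕 𝓕 (n + 1) M := by
  induction n generalizing M with
  | zero => exact ⟨M, _, _, LinearMap.id, hM, Function.surjective_id,
      hk _ _ LinearMap.id Function.surjective_id hM hM⟩
  | succ n ih =>
    obtain ⟨F, _, _, π, hF, hπ, hK⟩ := hM
    exact ⟨F, _, _, π, hF, hπ, ih hK⟩

/-- Transport of a resolution along a class `T` of homomorphisms. -/
theorem Res.transfer
    (T : ∀ {M N : Type u} [AddCommGroup M] [Module B M] [AddCommGroup N] [Module B N],
      (M →ₗ[B] N) → Prop)
    (hex : ∀ (F : Type u) [AddCommGroup F] [Module B F], 𝓕 F →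
      ∃ (N : Type u) (_ : AddCommGroup N) (_ : Module B N) (q : F →ₗ[B] N), T q ∧ 𝓕' N)
    (hker : ∀ {F M F' M' : Type u} [AddCommGroup F] [Module B F] [AddCommGroup M] [Module B M]
      [AddCommGroup F'] [Module B F'] [AddCommGroup M'] [Module B M'] (p : F →ₗ[B] M)
      (qF : F →ₗ[B] F') (q : M →ₗ[B] M'), Function.Surjective p → T qF → T q →
      ∃ p' : F' →ₗ[B] M', Function.Surjective p' ∧
        ∃ qK : LinearMap.ker p →ₗ[B] LinearMap.ker p', T qK ∧ ∀ k, (qK k).1 = qF k.1)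
    (h𝓠 : ∀ {M N : Type u} [AddCommGroup M] [Module B M] [AddCommGroup N] [Module B N]
      (q : M →ₗ[B] N), T q → 𝓠 M → 𝓠' N)
    (n : ℕ) {M N : Type u} [AddCommGroup M] [Module B M] [AddCommGroup N] [Module B N]
    (q : M →ₗ[B] N) (hq : T q) (hM : Res 𝓕 𝓠 n M) : Res 𝓕' 𝓠' n N := by
  induction n generalizing M N with
  | zero => exact h𝓠 q hq hM
  | succ n ih =>
    obtain ⟨F, _, _, p, hF, hp, hK⟩ := hM
    obtain ⟨F', _, _, qF, hqF, hF'⟩ := hex F hF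
    obtain ⟨p', hp', qK, hqK, -⟩ := hker p qF q hp hqF hq
    exact ⟨F', _, _, p', hF', hp', ih qK hqK hK⟩

end Resolutions

/-! ### Flat modules on which a multiplicative set acts bijectively -/

section Local

variable {A : Type u} [CommRing A] (B : Type u) [Ring B] [Algebra A B]

/-- Multiplication by a central element. -/
def cmul (M : Type u) [AddCommGroup M] [Module B M] (a : A) : M →ₗ[B] M where
  toFun m := algebraMap A B a • m
  map_add' := smul_add _
  map_smul' b m := algebraMap_smul_comm a b m

@[simp] theorem cmul_apply {M : Type u} [AddCommGroup M] [Module B M] (a : A) (m : M) :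
    cmul B M a m = algebraMap A B a • m := rfl

/-- The flat `B ⧸ I B`-modules on which `S` acts bijectively. -/
def LFlat (I : Ideal A) (S : Submonoid A) (M : Type u) [AddCommGroup M] [Module B M] : Prop :=
  RFlat B I M ∧ SLoc B S M

/-- `x` is a nonzerodivisor on the localization of `B ⧸ I B` at `S`. -/
def RegularMod (I : Ideal A) (S : Submonoid A) (x : A) : Prop :=
  ∀ b : B, algebraMap A B x * b ∈ I • (⊤ : Submodule A B) →
    ∃ s ∈ S, algebraMap A B s * b ∈ I • (⊤ : Submodule A B)

/-- The left ideal `I B`. -/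
def extIdeal (I : Ideal A) : Ideal B where
  carrier := (I • (⊤ : Submodule A B) : Submodule A B)
  add_mem' := add_mem
  zero_mem' := zero_mem _
  smul_mem' b c hc := by
    induction hc using Submodule.smul_induction_on' with
    | smul a ha r _ =>
      rw [smul_eq_mul, mul_smul_comm]
      exact Submodule.smul_mem_smul ha trivial
    | add c _ d _ hc hd => rw [smul_add]; exact add_mem hc hd

variable {B} {I : Ideal A} {S : Submonoid A} {x : A}

theorem mem_extIdeal {b : B} : b ∈ extIdeal B I ↔ b ∈ I • (⊤ : Submodule A B) := Iff.rfl

theorem killed_quotient_extIdeal : Killed B I (B ⧸ extIdeal B I) := fun a ha m => by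
  obtain ⟨b, rfl⟩ := Submodule.Quotient.mk_surjective _ m
  rw [← Submodule.Quotient.mk_smul, Submodule.Quotient.mk_eq_zero, mem_extIdeal, smul_eq_mul,
    ← Algebra.smul_def]
  exact Submodule.smul_mem_smul ha trivial

theorem op_mem_smul_top {r : Bᵐᵒᵖ} :
    r ∈ I • (⊤ : Submodule A Bᵐᵒᵖ) ↔ r.unop ∈ I • (⊤ : Submodule A B) := by
  have h := Submodule.map_smul'' I (⊤ : Submodule A Bᵐᵒᵖ)
    (MulOpposite.opLinearEquiv A (M := B)).symm.toLinearMap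
  rw [Submodule.map_top, LinearMap.range_eq_top.2 (LinearEquiv.surjective _)] at h
  rw [← h]
  constructor
  · exact fun hr => ⟨r, hr, rfl⟩
  · rintro ⟨r', hr', e⟩
    have : r' = r := MulOpposite.unop_injective e
    rwa [← this]

theorem RegularMod.op (h : RegularMod B I S x) : RegularMod Bᵐᵒᵖ I S x := fun r hr => by
  rw [op_mem_smul_top, MulOpposite.algebraMap_apply, MulOpposite.unop_mul, MulOpposite.unop_op,
    ← Algebra.commutes] at hr
  obtain ⟨s, hs, h⟩ := h _ hr
  refine ⟨s, hs, ?_⟩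
  rwa [op_mem_smul_top, MulOpposite.algebraMap_apply, MulOpposite.unop_mul, MulOpposite.unop_op,
    ← Algebra.commutes]

variable {M N : Type u} [AddCommGroup M] [Module B M] [AddCommGroup N] [Module B N]

theorem Killed.smul_eq_zero (h : Killed B I M) {b : B} (hb : b ∈ I • (⊤ : Submodule A B)) (m : M) :
    b • m = 0 := by
  induction hb using Submodule.smul_induction_on' with
  | smul a ha r _ => rw [Algebra.smul_def, mul_smul, h a ha]
  | add c _ d _ hc hd => rw [add_smul, hc, hd, add_zero]

/-- The assignment `x ↦ e` is well defined on the cyclic submodule of `B ⧸ I B` generated by `x`: if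
`b x ∈ I B`, then `s b ∈ I B` for some `s ∈ S`, so `s b e = 0` and hence `b e = 0`. Extending it to
`B ⧸ I B` and evaluating at `1` divides `e` by `x`. -/
theorem RInj.divisible (hE : RInj B I M) (hK : Killed B I M) (hS : SLoc B S M)
    (hx : RegularMod B I S x) (e : M) : ∃ e' : M, algebraMap A B x • e' = e := by
  obtain ⟨f, hf⟩ := hE.exists_apply_eq (killed_quotient_extIdeal (B := B) (I := I))
    (Submodule.Quotient.mk (algebraMap A B x)) e (fun b hb => by
      rw [← Submodule.Quotient.mk_smul, Submodule.Quotient.mk_eq_zero, smul_eq_mul,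
        ← Algebra.commutes] at hb
      obtain ⟨s, hs, h⟩ := hx b hb
      refine (hS s hs).1 ?_
      simp only [smul_zero]
      rw [← mul_smul, hK.smul_eq_zero h])
  refine ⟨f (Submodule.Quotient.mk 1), ?_⟩
  rw [← f.map_smul, ← Submodule.Quotient.mk_smul, smul_eq_mul, mul_one, hf]

theorem SLoc.rChar (h : SLoc B S M) : SLoc Bᵐᵒᵖ S (RChar B M) := fun s hs => by
  have : (fun c : RChar B M => algebraMap A Bᵐᵒᵖ s • c) = RChar.map (cmul B M s) := by
    ext c m
    simp [MulOpposite.algebraMap_apply]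
  rw [this]
  exact ⟨RChar.map_injective _ (h s hs).2, RChar.map_surjective _ (h s hs).1⟩

/-- Dual to divisibility: every character of `M` is an `x`-multiple, so it vanishes on `x`-torsion.
-/
theorem LFlat.injective_smul (hF : LFlat B I S M) (hx : RegularMod B I S x) :
    Function.Injective (fun m : M => algebraMap A B x • m) := by
  change Function.Injective (cmul B M x)
  rw [injective_iff_map_eq_zero]
  intro m hm
  refine eq_zero_of_addChar (fun c => ?_)
  obtain ⟨c', hc'⟩ := hF.1.2.divisible hF.1.1.rChar hF.2.rChar hx.op c
  have := DFunLike.congr_fun hc' m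
  rw [RChar.smul_apply, MulOpposite.algebraMap_apply, MulOpposite.unop_op, ← cmul_apply, hm,
    map_zero] at this
  exact this.symm

theorem LFlat.equiv (h : LFlat B I S M) (e : M ≃ₗ[B] N) : LFlat B I S N :=
  ⟨h.1.equiv e, h.2.equiv e⟩

theorem LFlat.ker (hM : LFlat B I S M) (hN : LFlat B I S N) (p : M →ₗ[B] N)
    (hp : Function.Surjective p) : LFlat B I S (LinearMap.ker p) :=
  ⟨hM.1.ker hN.1 p hp, hM.2.ker hN.2 p⟩

end Local

/-! ### Reduction modulo a central nonzerodivisor -/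

section Reduction

variable {A : Type u} [CommRing A] {B : Type u} [Ring B] [Algebra A B]
  {I : Ideal A} {S : Submonoid A} {x : A}

/-- `q` identifies `N` with `M ⧸ x M`, where `x` is a nonzerodivisor on `M`. -/
def IsReduction (x : A) {M N : Type u} [AddCommGroup M] [Module B M] [AddCommGroup N]
    [Module B N] (q : M →ₗ[B] N) : Prop :=
  Function.Injective (cmul B M x) ∧ Function.Surjective q ∧
    ∀ m, q m = 0 ↔ ∃ m', algebraMap A B x • m' = m

variable {M N : Type u} [AddCommGroup M] [Module B M] [AddCommGroup N] [Module B N]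

theorem isReduction_mkQ (hM : Function.Injective (cmul B M x)) :
    IsReduction x (LinearMap.range (cmul B M x)).mkQ :=
  ⟨hM, Submodule.mkQ_surjective _, fun m => by
    rw [Submodule.mkQ_apply, Submodule.Quotient.mk_eq_zero]; rfl⟩

theorem IsReduction.killed {q : M →ₗ[B] N} (hq : IsReduction x q) (hM : Killed B I M) :
    Killed B (I ⊔ Ideal.span {x}) N := fun a ha n => by
  obtain ⟨m, rfl⟩ := hq.2.1 n
  obtain ⟨i, hi, j, hj, rfl⟩ := Submodule.mem_sup.1 ha
  obtain ⟨b, rfl⟩ := Ideal.mem_span_singleton'.1 hj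
  rw [map_add, add_smul, ← q.map_smul, hM i hi, map_zero, zero_add, ← q.map_smul, hq.2.2]
  exact ⟨algebraMap A B b • m, by rw [← mul_smul, ← map_mul, mul_comm]⟩

/-- Characters of `M ⧸ x M` are the `x`-torsion of `M⁺`, and any map to `M⁺` from a module killed by
`x` lands there. -/
theorem IsReduction.rFlat {q : M →ₗ[B] N} (hq : IsReduction x q) (hM : RFlat B I M) :
    RFlat B (I ⊔ Ideal.span {x}) N := by
  refine ⟨hq.killed hM.1, fun Y Y' _ _ _ _ i hi hY hY' g => ?_⟩
  obtain ⟨g', hg'⟩ := hM.2 Y Y' i hi (hY.mono le_sup_left) (hY'.mono le_sup_left)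
    (RChar.map q ∘ₗ g)
  obtain ⟨k, hk⟩ := exists_factor_of_injective (RChar.map q) (RChar.map_injective q hq.2.1) g'
    (fun y => RChar.exists_map_eq q hq.2.1 _ (fun m hm => by
      obtain ⟨m', rfl⟩ := (hq.2.2 m).1 hm
      have h₁ : algebraMap A Bᵐᵒᵖ x • y = 0 :=
        hY' x (le_sup_right (α := Ideal A) (Ideal.mem_span_singleton_self x)) y
      have h₂ : (algebraMap A Bᵐᵒᵖ x • g' y) m' = 0 := by
        rw [← g'.map_smul, h₁, map_zero, RChar.zero_apply]
      simpa [MulOpposite.algebraMap_apply] using h₂))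
  refine ⟨k, fun y => RChar.map_injective q hq.2.1 ?_⟩
  rw [hk, hg', LinearMap.comp_apply]

theorem IsReduction.sLoc {q : M →ₗ[B] N} (hq : IsReduction x q) (hM : SLoc B S M) :
    SLoc B S N := fun s hs => by
  constructor
  · change Function.Injective (cmul B N s)
    rw [injective_iff_map_eq_zero]
    intro n hn
    obtain ⟨m, rfl⟩ := hq.2.1 n
    rw [cmul_apply, ← q.map_smul, hq.2.2] at hn
    obtain ⟨m', hm'⟩ := hn
    obtain ⟨m'', rfl⟩ := (hM s hs).2 m'
    rw [hq.2.2]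
    refine ⟨m'', (hM s hs).1 ?_⟩
    change algebraMap A B s • algebraMap A B x • m'' = algebraMap A B s • m
    rw [← hm', algebraMap_smul_comm]
  · intro n
    obtain ⟨m, rfl⟩ := hq.2.1 n
    obtain ⟨m', rfl⟩ := (hM s hs).2 m
    exact ⟨q m', (q.map_smul _ _).symm⟩

theorem IsReduction.lFlat {q : M →ₗ[B] N} (hq : IsReduction x q) (hM : LFlat B I S M) :
    LFlat B (I ⊔ Ideal.span {x}) S N :=
  ⟨hq.rFlat hM.1, hq.sLoc hM.2⟩

/-- Since `x` is a nonzerodivisor on `M`, the sequence `0 → ker p → F → M → 0` stays exact after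
division by `x`. -/
theorem IsReduction.exists_ker {F M F' M' : Type u} [AddCommGroup F] [Module B F] [AddCommGroup M]
    [Module B M] [AddCommGroup F'] [Module B F'] [AddCommGroup M'] [Module B M'] (p : F →ₗ[B] M)
    (qF : F →ₗ[B] F') (q : M →ₗ[B] M') (hp : Function.Surjective p) (hqF : IsReduction x qF)
    (hq : IsReduction x q) :
    ∃ p' : F' →ₗ[B] M', Function.Surjective p' ∧
      ∃ qK : LinearMap.ker p →ₗ[B] LinearMap.ker p', IsReduction x qK ∧ ∀ k, (qK k).1 = qF k.1 := by
  obtain ⟨p', hp'⟩ := exists_factor_of_surjective qF hqF.2.1 (q ∘ₗ p) (fun f hf => by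
    obtain ⟨f', rfl⟩ := (hqF.2.2 f).1 hf
    rw [LinearMap.comp_apply, p.map_smul]
    exact (hq.2.2 _).2 ⟨_, rfl⟩)
  have hs : Function.Surjective p' := fun m' => by
    obtain ⟨m, rfl⟩ := hq.2.1 m'
    obtain ⟨f, rfl⟩ := hp m
    exact ⟨qF f, hp' f⟩
  let qK : LinearMap.ker p →ₗ[B] LinearMap.ker p' := qF.restrict (fun f hf => by
    rw [LinearMap.mem_ker, hp', LinearMap.comp_apply, show p f = 0 from hf, map_zero])
  refine ⟨p', hs, qK, ⟨fun k k' h => Subtype.ext (hqF.1 (congrArg Subtype.val h)), ?_, ?_⟩,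
    fun _ => rfl⟩
  · rintro ⟨f', hf'⟩
    obtain ⟨f, rfl⟩ := hqF.2.1 f'
    rw [LinearMap.mem_ker, hp', LinearMap.comp_apply, hq.2.2] at hf'
    obtain ⟨m, hm⟩ := hf'
    obtain ⟨g, rfl⟩ := hp m
    refine ⟨⟨f - algebraMap A B x • g, by simp [← hm]⟩, Subtype.ext ?_⟩
    change qF (f - algebraMap A B x • g) = qF f
    rw [map_sub, (hqF.2.2 (algebraMap A B x • g)).2 ⟨g, rfl⟩, sub_zero]
  · rintro ⟨k, hk⟩
    constructor
    · intro h
      obtain ⟨f, rfl⟩ := (hqF.2.2 k).1 (congrArg Subtype.val h)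
      refine ⟨⟨f, hq.1 ?_⟩, rfl⟩
      rw [LinearMap.mem_ker, p.map_smul] at hk
      rw [map_zero, cmul_apply, hk]
    · rintro ⟨k', hk'⟩
      exact Subtype.ext ((hqF.2.2 k).2 ⟨k'.1, congrArg Subtype.val hk'⟩)

theorem IsReduction.res (hx : RegularMod B I S x)
    {𝓠 𝓠' : ∀ (M : Type u) [AddCommGroup M] [Module B M], Prop}
    (h𝓠 : ∀ {M N : Type u} [AddCommGroup M] [Module B M] [AddCommGroup N] [Module B N]
      (q : M →ₗ[B] N), IsReduction x q → 𝓠 M → 𝓠' N)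
    (n : ℕ) {q : M →ₗ[B] N} (hq : IsReduction x q) (hM : Res (LFlat B I S) 𝓠 n M) :
    Res (LFlat B (I ⊔ Ideal.span {x}) S) 𝓠' n N :=
  Res.transfer (𝓕' := LFlat B (I ⊔ Ideal.span {x}) S) (fun {_ _} _ _ _ _ q => IsReduction x q)
    (fun _ _ _ hF => ⟨_, _, _, _, isReduction_mkQ (hF.injective_smul hx),
      (isReduction_mkQ (hF.injective_smul hx)).lFlat hF⟩)
    IsReduction.exists_ker h𝓠 n q hq hM

/-- Passing from a relatively injective module to its `x`-torsion lowers the flat dimension. -/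
theorem res_ker_cmul {E : Type u} [AddCommGroup E] [Module B E] (hx : RegularMod B I S x)
    (hE : RInj B I E) (hK : Killed B I E) (hS : SLoc B S E) (n : ℕ)
    (h : Res (LFlat B I S) (LFlat B I S) (n + 1) E) :
    Res (LFlat B (I ⊔ Ideal.span {x}) S) (LFlat B (I ⊔ Ideal.span {x}) S) n
      (LinearMap.ker (cmul B E x)) := by
  obtain ⟨F, _, _, p, hF, hp, hKer⟩ := h
  have hFx : Function.Injective (cmul B F x) := hF.injective_smul hx
  have hKx : Function.Injective (cmul B (LinearMap.ker p) x) := fun k k' h =>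
    Subtype.ext (hFx (congrArg Subtype.val h))
  have rF := isReduction_mkQ hFx
  have rK := isReduction_mkQ hKx
  set qF := (LinearMap.range (cmul B F x)).mkQ
  set qK := (LinearMap.range (cmul B (LinearMap.ker p) x)).mkQ
  -- With `K = ker p`, the map `u : K/xK → F/xF` is onto because `E` is `x`-divisible. As `F/xF` is
  -- flat and `K/xK` has a resolution of length `n`, so does `ker u`, which computes `Tor₁` of `E`
  -- with the quotient by `x`.
  obtain ⟨u, hu⟩ := exists_factor_of_surjective qK rK.2.1 (qF ∘ₗ (LinearMap.ker p).subtype)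
    (fun k hk => by
      obtain ⟨k', rfl⟩ := (rK.2.2 k).1 hk
      exact (rF.2.2 _).2 ⟨k'.1, rfl⟩)
  have hus : Function.Surjective u := fun f' => by
    obtain ⟨f, rfl⟩ := rF.2.1 f'
    obtain ⟨e, he⟩ := hE.divisible hK hS hx (p f)
    obtain ⟨g, rfl⟩ := hp e
    refine ⟨qK ⟨f - algebraMap A B x • g, by simp [he]⟩, ?_⟩
    rw [hu, LinearMap.comp_apply, Submodule.subtype_apply, map_sub,
      (rF.2.2 (algebraMap A B x • g)).2 ⟨g, rfl⟩, sub_zero]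
  have hres : Res (LFlat B (I ⊔ Ideal.span {x}) S) (LFlat B (I ⊔ Ideal.span {x}) S) n
      (LinearMap.ker u) :=
    Res.ker (fun _ _ _ _ _ _ e h => h.equiv e) (fun _ _ _ _ _ _ p hp hM hN => hM.ker hN p hp)
      n u hus (rK.res hx (fun q hq hM => hq.lFlat hM) n hKer) (rF.lFlat hF)
  -- The snake isomorphism between the `x`-torsion of `E` and `ker u`, sending `p f` to the class of
  -- `x f`. Both maps out of `U` are onto and have kernel `ker p`.
  let U := LinearMap.ker (cmul B E x ∘ₗ p)
  let a : U →ₗ[B] LinearMap.ker (cmul B E x) := p.restrict (fun f hf => hf)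
  have ha : Function.Surjective a := by
    rintro ⟨e, he⟩
    obtain ⟨f, rfl⟩ := hp e
    exact ⟨⟨f, he⟩, rfl⟩
  let m : U →ₗ[B] LinearMap.ker p := (cmul B F x).restrict (fun f hf => by
    have : cmul B E x (p f) = 0 := hf
    rwa [LinearMap.mem_ker, cmul_apply, p.map_smul])
  let b : U →ₗ[B] LinearMap.ker u := (qK ∘ₗ m).codRestrict _ (fun f => by
    rw [LinearMap.mem_ker, LinearMap.comp_apply, hu]
    exact (rF.2.2 _).2 ⟨f.1, rfl⟩)
  have hb : Function.Surjective b := by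
    rintro ⟨k', hk'⟩
    obtain ⟨k, rfl⟩ := rK.2.1 k'
    rw [LinearMap.mem_ker, hu] at hk'
    obtain ⟨f, hf⟩ := (rF.2.2 _).1 hk'
    refine ⟨⟨f, ?_⟩, Subtype.ext (congrArg qK (Subtype.ext hf))⟩
    have : p k.1 = 0 := k.2
    rw [LinearMap.mem_ker, LinearMap.comp_apply, cmul_apply, ← p.map_smul, hf]
    exact this
  have hab : LinearMap.ker a = LinearMap.ker b := by
    ext f
    constructor
    · intro hf
      refine Subtype.ext ((rK.2.2 _).2 ⟨⟨f.1, congrArg Subtype.val hf⟩, rfl⟩)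
    · intro hf
      obtain ⟨k, hk⟩ := (rK.2.2 _).1 (congrArg Subtype.val hf)
      have : k.1 = f.1 := hFx (congrArg Subtype.val hk)
      refine Subtype.ext ?_
      change p f.1 = 0
      rw [← this]
      exact k.2
  exact hres.equiv (fun _ _ _ _ _ _ e h => h.equiv e) n
    ((b.quotKerEquivOfSurjective hb).symm ≪≫ₗ (Submodule.quotEquivOfEq _ _ hab.symm) ≪≫ₗ
      (a.quotKerEquivOfSurjective ha))

theorem RInj.ker_cmul {E : Type u} [AddCommGroup E] [Module B E] (hE : RInj B I E) :
    RInj B (I ⊔ Ideal.span {x}) (LinearMap.ker (cmul B E x)) := fun X X' _ _ _ _ i hi hX hX' g => by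
  obtain ⟨g', hg'⟩ := hE X X' i hi (hX.mono le_sup_left) (hX'.mono le_sup_left)
    ((LinearMap.ker (cmul B E x)).subtype ∘ₗ g)
  refine ⟨g'.codRestrict _ (fun y => ?_), fun y => Subtype.ext (hg' y)⟩
  rw [LinearMap.mem_ker, cmul_apply, ← g'.map_smul,
    hX' x (le_sup_right (α := Ideal A) (Ideal.mem_span_singleton_self x)) y, map_zero]

theorem Killed.ker_cmul (hM : Killed B I M) :
    Killed B (I ⊔ Ideal.span {x}) (LinearMap.ker (cmul B M x)) := fun a ha m => by
  obtain ⟨i, hi, j, hj, rfl⟩ := Submodule.mem_sup.1 ha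
  obtain ⟨b, rfl⟩ := Ideal.mem_span_singleton'.1 hj
  refine Subtype.ext ?_
  change algebraMap A B (i + b * x) • m.1 = 0
  have : algebraMap A B x • m.1 = 0 := m.2
  rw [map_add, add_smul, hM i hi, zero_add, map_mul, mul_smul, this, smul_zero]

end Reduction

/-! ### Localization at a central multiplicative set -/

section Localization

variable {A : Type u} [CommRing A] {B : Type u} [Ring B] [Algebra A B] {S : Submonoid A}

/-- `q` identifies `N` with the localization of `M` at `S`. -/
def IsLoc (S : Submonoid A) {M N : Type u} [AddCommGroup M] [Module B M] [AddCommGroup N]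
    [Module B N] (q : M →ₗ[B] N) : Prop :=
  SLoc B S N ∧ (∀ m, q m = 0 → ∃ s ∈ S, algebraMap A B s • m = 0) ∧
    ∀ n, ∃ s ∈ S, ∃ m, algebraMap A B s • n = q m

variable {M N P : Type u} [AddCommGroup M] [Module B M] [AddCommGroup N] [Module B N]
  [AddCommGroup P] [Module B P]

theorem SLoc.isLoc_id (h : SLoc B S M) : IsLoc S (LinearMap.id : M →ₗ[B] M) :=
  ⟨h, fun m hm => ⟨1, S.one_mem, by rw [show m = 0 from hm, smul_zero]⟩,
    fun m => ⟨1, S.one_mem, m, by simp⟩⟩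

variable (S) in
-- The localization of the underlying `A`-module works: `B` acts on it by functoriality, because `A`
-- is central.
theorem exists_isLoc (M : Type u) [AddCommGroup M] [Module B M] :
    ∃ (N : Type u) (_ : AddCommGroup N) (_ : Module B N) (q : M →ₗ[B] N), IsLoc S q := by
  let _ : Module A M := Module.compHom M (algebraMap A B)
  have : IsScalarTower A B M := ⟨fun a b m => by
    rw [Algebra.smul_def, mul_smul]; rfl⟩
  let L := LocalizedModule S M
  let f : M →ₗ[A] L := LocalizedModule.mkLinearMap S M
  let φ : B →+* Module.End A L :=
    { toFun := fun b => IsLocalizedModule.map S f f (Algebra.lsmul A A M b)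
      map_one' := by rw [map_one]; exact IsLocalizedModule.map_id S f
      map_mul' := fun b c => by rw [map_mul]; exact IsLocalizedModule.map_comp' S f f f _ _
      map_zero' := by rw [map_zero, map_zero]
      map_add' := fun b c => by rw [map_add, map_add] }
  let _ : Module B L := Module.compHom L φ
  have hφ : ∀ (b : B) (m : M), b • f m = f (b • m) := fun b m => IsLocalizedModule.map_apply S f f (Algebra.lsmul A A M b) m
  have hA : ∀ (a : A) (l : L), algebraMap A B a • l = a • l := fun a l => by
    change φ (algebraMap A B a) l = a • l
    have : φ (algebraMap A B a) = a • LinearMap.id := by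
      refine IsLocalizedModule.ext S f (IsLocalizedModule.map_units f) ?_
      ext m
      change algebraMap A B a • f m = a • f m
      rw [hφ, ← f.map_smul]; rfl
    rw [this]; rfl
  refine ⟨L, inferInstance, inferInstance, ⟨f.toAddHom, fun b m => (hφ b m).symm⟩, ?_, ?_, ?_⟩
  · intro s hs
    simp only [hA]
    exact (Module.End.isUnit_iff _).1 (IsLocalizedModule.map_units f ⟨s, hs⟩)
  · intro m hm
    obtain ⟨s, hs⟩ := (IsLocalizedModule.eq_zero_iff S f).1 hm
    exact ⟨s, s.2, hs⟩
  · intro n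
    obtain ⟨⟨m, s⟩, h⟩ := IsLocalizedModule.surj S f n
    exact ⟨s, s.2, m, by rw [hA]; exact h⟩

theorem IsLoc.exists_lift {q : M →ₗ[B] N} (hq : IsLoc S q) (hP : SLoc B S P) (g : M →ₗ[B] P) :
    ∃ g' : N →ₗ[B] P, ∀ m, g' (q m) = g m := by
  choose s hs m hm using hq.2.2
  choose g' hg' using fun n => (hP (s n) (hs n)).2 (g (m n))
  -- Independence of the chosen denominator. Linearity of `g'` then follows after multiplying by a
  -- common denominator.
  have key : ∀ t ∈ S, ∀ n k, algebraMap A B t • n = q k → algebraMap A B t • g' n = g k := by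
    intro t ht n k hk
    refine (hP (s n) (hs n)).1 ?_
    change algebraMap A B (s n) • algebraMap A B t • g' n = algebraMap A B (s n) • g k
    rw [algebraMap_smul_comm, show algebraMap A B (s n) • g' n = g (m n) from hg' n, ← sub_eq_zero,
      ← g.map_smul, ← g.map_smul, ← map_sub]
    obtain ⟨r, hr, h⟩ := hq.2.1 (algebraMap A B t • m n - algebraMap A B (s n) • k) (by
      rw [map_sub, q.map_smul, q.map_smul, ← hm, ← hk, algebraMap_smul_comm, sub_self])
    refine (hP r hr).1 ?_
    simp only [smul_zero]
    rw [← g.map_smul, h, map_zero]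
  refine ⟨⟨⟨g', fun n n' => ?_⟩, fun b n => ?_⟩, fun k => ?_⟩
  · refine (hP _ (mul_mem (hs n) (hs n'))).1 ?_
    change algebraMap A B (s n * s n') • g' (n + n') = algebraMap A B (s n * s n') • (g' n + g' n')
    rw [key _ (mul_mem (hs n) (hs n')) (n + n')
      (algebraMap A B (s n') • m n + algebraMap A B (s n) • m n')]
    · rw [map_add, g.map_smul, g.map_smul, ← hg' n, ← hg' n', smul_add, map_mul, mul_smul, mul_smul,
        algebraMap_smul_comm (s n) (algebraMap A B (s n')) (g' n)]
    · rw [map_add, q.map_smul, q.map_smul, ← hm, ← hm, smul_add, map_mul, mul_smul, mul_smul,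
        algebraMap_smul_comm (s n) (algebraMap A B (s n')) n]
  · refine (hP _ (hs n)).1 ?_
    change algebraMap A B (s n) • g' (b • n) = algebraMap A B (s n) • b • g' n
    rw [key _ (hs n) (b • n) (b • m n), g.map_smul, ← hg' n, algebraMap_smul_comm]
    rw [algebraMap_smul_comm, hm, q.map_smul]
  · have := key 1 S.one_mem (q k) k (by simp)
    simpa using this

theorem IsLoc.exists_map_injective {M M' N N' : Type u} [AddCommGroup M] [Module B M]
    [AddCommGroup M'] [Module B M'] [AddCommGroup N] [Module B N] [AddCommGroup N'] [Module B N']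
    {q : M →ₗ[B] N} {q' : M' →ₗ[B] N'} (hq : IsLoc S q) (hq' : IsLoc S q') (i : M →ₗ[B] M')
    (hi : Function.Injective i) :
    ∃ j : N →ₗ[B] N', Function.Injective j ∧ ∀ m, j (q m) = q' (i m) := by
  obtain ⟨j, hj⟩ := hq.exists_lift hq'.1 (q' ∘ₗ i)
  refine ⟨j, ?_, hj⟩
  rw [injective_iff_map_eq_zero]
  intro n hn
  obtain ⟨s, hs, m, hm⟩ := hq.2.2 n
  have : q' (i m) = 0 := by
    rw [← LinearMap.comp_apply, ← hj, ← hm, j.map_smul, hn, smul_zero]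
  obtain ⟨t, ht, h⟩ := hq'.2.1 _ this
  rw [← i.map_smul] at h
  have h0 := hi (h.trans (map_zero i).symm)
  refine (hq.1 _ (mul_mem ht hs)).1 ?_
  change algebraMap A B (t * s) • n = algebraMap A B (t * s) • 0
  rw [map_mul, mul_smul, hm, ← q.map_smul, h0, map_zero, smul_zero]

theorem SLoc.lChar {Y : Type u} [AddCommGroup Y] [Module Bᵐᵒᵖ Y] (h : SLoc Bᵐᵒᵖ S Y) :
    SLoc B S (LChar B Y) := fun s hs => by
  have : (fun c : LChar B Y => algebraMap A B s • c) = LChar.map (cmul Bᵐᵒᵖ Y s) := by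
    ext c m
    simp [MulOpposite.algebraMap_apply]
  rw [this]
  refine ⟨fun c c' hc => ?_, LChar.map_surjective _ (h s hs).1⟩
  ext y
  obtain ⟨y', rfl⟩ := (h s hs).2 y
  exact DFunLike.congr_fun hc y'

/-- The localization of a flat module is flat. -/
theorem IsLoc.rFlat {q : M →ₗ[B] N} (hq : IsLoc S q) (hM : RFlat B (⊥ : Ideal A) M) :
    RFlat B (⊥ : Ideal A) N := by
  refine ⟨killed_bot, fun Y Y' _ _ _ _ i hi _ _ g => ?_⟩
  -- The extension problem moves to the localizations `L → L'` and is solved there with values in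
  -- `M⁺`. The solution, read as a map `M → L'⁺`, factors through `N` because `S` acts bijectively
  -- on `L'⁺`.
  obtain ⟨L, _, _, ℓ, hℓ⟩ := exists_isLoc (B := Bᵐᵒᵖ) S Y
  obtain ⟨L', _, _, ℓ', hℓ'⟩ := exists_isLoc (B := Bᵐᵒᵖ) S Y'
  obtain ⟨j, hj, hji⟩ := hℓ.exists_map_injective hℓ' i hi
  obtain ⟨g₁, hg₁⟩ := hℓ.exists_lift hq.1.rChar g
  obtain ⟨g₂, hg₂⟩ := hM.2 L L' j hj killed_bot killed_bot (RChar.map q ∘ₗ g₁)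
  obtain ⟨g₃, hg₃⟩ := hq.exists_lift hℓ'.1.lChar (toLChar g₂)
  refine ⟨toRChar g₃ ∘ₗ ℓ', fun y => ?_⟩
  ext n
  change g₃ n (ℓ' (i y)) = g y n
  rw [← hg₁, ← hji]
  have key : LChar.map j ∘ₗ g₃ = toLChar g₁ := by
    ext n l
    obtain ⟨s, hs, m, hm⟩ := hq.2.2 n
    obtain ⟨l', rfl⟩ := (hℓ.1 s hs).2 l
    change g₃ n (j (algebraMap A Bᵐᵒᵖ s • l')) = g₁ (algebraMap A Bᵐᵒᵖ s • l') n
    rw [j.map_smul, g₁.map_smul, RChar.smul_apply, MulOpposite.algebraMap_apply,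
      ← LChar.smul_apply, ← g₃.map_smul, MulOpposite.unop_op, hm, hg₃, toLChar_apply, hg₂]
    rfl
  exact DFunLike.congr_fun (DFunLike.congr_fun key n) (ℓ y)

theorem IsLoc.lFlat {q : M →ₗ[B] N} (hq : IsLoc S q) (hM : RFlat B (⊥ : Ideal A) M) :
    LFlat B (⊥ : Ideal A) S N :=
  ⟨hq.rFlat hM, hq.1⟩

theorem IsLoc.exists_ker {F M F' M' : Type u} [AddCommGroup F] [Module B F] [AddCommGroup M]
    [Module B M] [AddCommGroup F'] [Module B F'] [AddCommGroup M'] [Module B M'] (p : F →ₗ[B] M)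
    (qF : F →ₗ[B] F') (q : M →ₗ[B] M') (hp : Function.Surjective p) (hqF : IsLoc S qF)
    (hq : IsLoc S q) :
    ∃ p' : F' →ₗ[B] M', Function.Surjective p' ∧
      ∃ qK : LinearMap.ker p →ₗ[B] LinearMap.ker p', IsLoc S qK ∧ ∀ k, (qK k).1 = qF k.1 := by
  obtain ⟨p', hp'⟩ := hqF.exists_lift hq.1 (q ∘ₗ p)
  let qK : LinearMap.ker p →ₗ[B] LinearMap.ker p' := qF.restrict (fun f hf => by
    rw [LinearMap.mem_ker, hp', LinearMap.comp_apply, show p f = 0 from hf, map_zero])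
  refine ⟨p', fun n => ?_, qK, ⟨hqF.1.ker hq.1 p', ?_, ?_⟩, fun _ => rfl⟩
  · obtain ⟨s, hs, m, hm⟩ := hq.2.2 n
    obtain ⟨f, rfl⟩ := hp m
    obtain ⟨f', hf'⟩ := (hqF.1 s hs).2 (qF f)
    refine ⟨f', (hq.1 s hs).1 ?_⟩
    change algebraMap A B s • p' f' = algebraMap A B s • n
    rw [← p'.map_smul, show algebraMap A B s • f' = qF f from hf', hp', hm, LinearMap.comp_apply]
  · intro k hk
    obtain ⟨s, hs, h⟩ := hqF.2.1 k.1 (congrArg Subtype.val hk)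
    exact ⟨s, hs, Subtype.ext h⟩
  · rintro ⟨n, hn⟩
    obtain ⟨s, hs, f, hf⟩ := hqF.2.2 n
    obtain ⟨t, ht, h⟩ := hq.2.1 (p f) (by
      rw [← LinearMap.comp_apply, ← hp', ← hf, p'.map_smul, show p' n = 0 from hn, smul_zero])
    refine ⟨t * s, mul_mem ht hs, ⟨algebraMap A B t • f, by rw [LinearMap.mem_ker, p.map_smul, h]⟩,
      Subtype.ext ?_⟩
    change algebraMap A B (t * s) • n = qF (algebraMap A B t • f)
    rw [map_mul, mul_smul, hf, qF.map_smul]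

theorem IsLoc.res {𝓠 𝓠' : ∀ (M : Type u) [AddCommGroup M] [Module B M], Prop}
    (h𝓠 : ∀ {M N : Type u} [AddCommGroup M] [Module B M] [AddCommGroup N] [Module B N]
      (q : M →ₗ[B] N), IsLoc S q → 𝓠 M → 𝓠' N)
    (n : ℕ) {q : M →ₗ[B] N} (hq : IsLoc S q)
    (hM : Res (IsFlat B) 𝓠 n M) :
    Res (LFlat B (⊥ : Ideal A) S) 𝓠' n N :=
  Res.transfer (𝓕' := LFlat B (⊥ : Ideal A) S) (fun {_ _} _ _ _ _ q => IsLoc S q)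
    (fun F _ _ hF => by
      obtain ⟨L, _, _, ℓ, hℓ⟩ := exists_isLoc (B := B) S F
      exact ⟨L, _, _, ℓ, hℓ, hℓ.lFlat (isFlat_iff_rFlat_bot.1 hF)⟩)
    IsLoc.exists_ker h𝓠 n q hq hM

end Localization

/-! ### Coinduced modules -/

section Coinduction

variable {A : Type u} [CommRing A] (B : Type u) [Ring B] [Algebra A B] (W : Type u)
  [AddCommGroup W] [Module A W]

/-- The coinduced left `B`-module `Hom_A(B, W)`. -/
def Coind : Type u := B →ₗ[A] W

instance : AddCommGroup (Coind (A := A) B W) := inferInstanceAs (AddCommGroup (B →ₗ[A] W))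

variable {B W}

instance : FunLike (Coind (A := A) B W) B W := inferInstanceAs (FunLike (B →ₗ[A] W) B W)

instance : LinearMapClass (Coind (A := A) B W) A B W :=
  inferInstanceAs (LinearMapClass (B →ₗ[A] W) A B W)

@[ext] theorem Coind.ext {f g : Coind (A := A) B W} (h : ∀ b, f b = g b) : f = g :=
  DFunLike.ext _ _ h

@[simp] theorem Coind.add_apply (f g : Coind (A := A) B W) (b : B) : (f + g) b = f b + g b := rfl

@[simp] theorem Coind.zero_apply (b : B) : (0 : Coind (A := A) B W) b = 0 := rfl

instance : SMul B (Coind (A := A) B W) :=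
  ⟨fun b f => (show B →ₗ[A] W from f) ∘ₗ LinearMap.mulRight A b⟩

@[simp] theorem Coind.smul_apply (b : B) (f : Coind (A := A) B W) (b' : B) :
    (b • f) b' = f (b' * b) := rfl

instance : Module B (Coind (A := A) B W) where
  one_smul f := by ext b; simp
  mul_smul r s f := by ext b; simp [mul_assoc]
  smul_zero r := by ext b; simp
  smul_add r f g := by ext b; simp
  add_smul r s f := by ext b; simp [mul_add]
  zero_smul f := by ext b; simp

theorem Coind.algebraMap_smul_apply (a : A) (f : Coind (A := A) B W) (b : B) :
    (algebraMap A B a • f) b = a • f b := by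
  rw [Coind.smul_apply, ← Algebra.commutes, ← Algebra.smul_def, map_smul]

/-- Coinduction is right adjoint to restriction of scalars, which preserves injections; the
adjunction is evaluation at `1`. -/
theorem Coind.injective (h : Module.Injective A W) : Module.Injective B (Coind (A := A) B W) := by
  refine ⟨fun X X' _ _ _ _ i hi g => ?_⟩
  let _ : Module A X := Module.compHom X (algebraMap A B)
  let _ : Module A X' := Module.compHom X' (algebraMap A B)
  let i₀ : X →ₗ[A] X' := ⟨i.toAddHom, fun a x => i.map_smul _ _⟩
  let g₀ : X →ₗ[A] W :=
    { toFun := fun x => g x 1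
      map_add' := fun x y => by rw [map_add]; rfl
      map_smul' := fun a x => by
        change g (algebraMap A B a • x) 1 = a • g x 1
        rw [g.map_smul, Coind.algebraMap_smul_apply] }
  obtain ⟨k, hk⟩ := h.out i₀ hi g₀
  refine ⟨{ toFun := fun y => (⟨⟨fun b => k (b • y), fun b b' => by rw [add_smul, map_add]⟩,
              fun a b => by
                change k ((a • b) • y) = a • k (b • y)
                rw [Algebra.smul_def, mul_smul, ← k.map_smul]
                rfl⟩ : B →ₗ[A] W)
            map_add' := fun y z => Coind.ext fun b => by
              change k (b • (y + z)) = k (b • y) + k (b • z)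
              rw [smul_add, map_add]
            map_smul' := fun r y => Coind.ext fun b => by
              change k (b • r • y) = k ((b * r) • y)
              rw [mul_smul] }, fun x => Coind.ext fun b => ?_⟩
  change k (b • i x) = g x b
  rw [← i.map_smul]
  refine (hk (b • x)).trans ?_
  change g (b • x) 1 = g x b
  rw [g.map_smul, Coind.smul_apply, one_mul]

theorem Coind.sLoc {S : Submonoid A} (h : SLoc A S W) : SLoc B S (Coind (A := A) B W) := by
  intro s hs
  constructor
  · intro f g hfg
    ext b
    have := DFunLike.congr_fun hfg b
    simp only [Coind.algebraMap_smul_apply] at this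
    exact (h s hs).1 this
  · intro f
    let e := LinearEquiv.ofBijective (cmul A W s) (h s hs)
    refine ⟨e.symm.toLinearMap ∘ₗ (show B →ₗ[A] W from f), Coind.ext fun b => ?_⟩
    refine (Coind.algebraMap_smul_apply s _ b).trans ?_
    exact e.apply_symm_apply (f b)

end Coinduction

/-! ### Group algebras -/

section GroupAlgebra

variable {A : Type u} [CommRing A] {G : Type u} [Group G] {I : Ideal A} {S : Submonoid A} {x : A}

theorem regularMod_self_iff :
    RegularMod A I S x ↔ ∀ b, x * b ∈ I → ∃ s ∈ S, s * b ∈ I := by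
  simp [RegularMod]

theorem mem_smul_top_iff_coeff {b : MonoidAlgebra A G} :
    b ∈ I • (⊤ : Submodule A (MonoidAlgebra A G)) ↔ ∀ g, b.coeff g ∈ I := by
  constructor
  · intro hb g
    induction hb using Submodule.smul_induction_on' with
    | smul a ha r _ =>
      rw [MonoidAlgebra.coeff_smul_apply]
      exact I.mul_mem_right _ ha
    | add c _ d _ hc hd => exact add_mem hc hd
  · intro h
    rw [← MonoidAlgebra.sum_coeff_single b]
    refine Submodule.sum_mem _ (fun g _ => ?_)
    have : MonoidAlgebra.single g (b.coeff g) =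
        b.coeff g • (MonoidAlgebra.single g 1 : MonoidAlgebra A G) := by simp
    rw [this]
    exact Submodule.smul_mem_smul (h g) trivial

/-- The condition is checked coefficientwise; the support of `b` is finite, so the denominators can
be multiplied together. -/
theorem RegularMod.monoidAlgebra (h : RegularMod A I S x) :
    RegularMod (MonoidAlgebra A G) I S x := by
  rw [regularMod_self_iff] at h
  intro b hb
  rw [← Algebra.smul_def, mem_smul_top_iff_coeff] at hb
  choose s hs hsb using fun g => h (b.coeff g) (hb g)
  classical
  refine ⟨∏ g ∈ b.coeff.support, s g, prod_mem (fun g _ => hs g), ?_⟩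
  rw [← Algebra.smul_def, mem_smul_top_iff_coeff]
  intro g
  rw [MonoidAlgebra.coeff_smul_apply, smul_eq_mul]
  by_cases hg : g ∈ b.coeff.support
  · rw [← Finset.prod_erase_mul _ _ hg, mul_assoc]
    exact I.mul_mem_left _ (hsb g)
  · rw [Finsupp.notMem_support_iff.1 hg, mul_zero]
    exact I.zero_mem

/-- Modulo `I`, the coefficients of `b` are constant on each coset `H g`. The coset is infinite and
the support finite, so they vanish. -/
theorem coeff_mem_of_invariant {H : Subgroup G} [Infinite H] {T : Set G}
    (hT : Subgroup.closure T = H) {b : MonoidAlgebra A G}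
    (h : ∀ t ∈ T, (MonoidAlgebra.single t 1 - 1) * b ∈ I • (⊤ : Submodule A (MonoidAlgebra A G))) :
    b ∈ I • (⊤ : Submodule A (MonoidAlgebra A G)) := by
  have key : ∀ k ∈ H, ∀ g, b.coeff (k * g) - b.coeff g ∈ I := by
    intro k hk
    rw [← hT] at hk
    induction hk using Subgroup.closure_induction with
    | mem t ht =>
      intro g
      have := mem_smul_top_iff_coeff.1 (h t ht) (t * g)
      rw [sub_mul, one_mul, MonoidAlgebra.coeff_sub, Finsupp.sub_apply,
        MonoidAlgebra.coeff_single_mul_eq_mul_coeff g (by simp), one_mul] at this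
      rw [← neg_sub]
      exact I.neg_mem this
    | one => simp
    | mul k l _ _ hk hl =>
      intro g
      rw [mul_assoc, ← sub_add_sub_cancel]
      exact I.add_mem (hk _) (hl g)
    | inv k _ hk =>
      intro g
      have := I.neg_mem (hk (k⁻¹ * g))
      rwa [mul_inv_cancel_left, neg_sub] at this
  rw [mem_smul_top_iff_coeff]
  intro g
  by_contra hg
  refine Set.infinite_range_of_injective (f := fun k : H => k.1 * g)
    (fun k l hkl => Subtype.ext (mul_right_cancel hkl)) (b.coeff.support.finite_toSet.subset ?_)
  rintro _ ⟨k, rfl⟩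
  rw [Finset.mem_coe, Finsupp.mem_support_iff]
  intro h0
  have := key k.1 k.2 g
  rw [h0, zero_sub] at this
  exact hg (neg_mem_iff.1 this)

variable (G) in
/-- There is a relatively injective module, of relative flat dimension at most `n`, with a nonzero
`G`-fixed element annihilated by `p`. -/
def HasFixed (p : Ideal A) [p.IsPrime] (I : Ideal A) (n : ℕ) : Prop :=
  ∃ (E : Type u) (_ : AddCommGroup E) (_ : Module (MonoidAlgebra A G) E),
    Killed (MonoidAlgebra A G) I E ∧ SLoc (MonoidAlgebra A G) p.primeCompl E ∧
    RInj (MonoidAlgebra A G) I E ∧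
    Res (LFlat (MonoidAlgebra A G) I p.primeCompl) (LFlat (MonoidAlgebra A G) I p.primeCompl) n E ∧
    ∃ e : E, e ≠ 0 ∧ (∀ g : G, (MonoidAlgebra.single g 1 : MonoidAlgebra A G) • e = e) ∧
      ∀ a ∈ p, algebraMap A (MonoidAlgebra A G) a • e = 0

variable {p : Ideal A} [p.IsPrime]

/-- The fixed element survives because `x ∈ p` kills it, so it lies in the `x`-torsion. -/
theorem HasFixed.reduce {n : ℕ} (h : HasFixed G p I (n + 1)) (hxp : x ∈ p)
    (hx : RegularMod A I p.primeCompl x) : HasFixed G p (I ⊔ Ideal.span {x}) n := by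
  obtain ⟨E, _, _, hK, hS, hE, hr, e, he, hf, hp⟩ := h
  exact ⟨LinearMap.ker (cmul _ E x), inferInstance, inferInstance, hK.ker_cmul, hS.ker hS _,
    hE.ker_cmul, res_ker_cmul hx.monoidAlgebra hE hK hS n hr, ⟨e, hp x hxp⟩,
    fun h0 => he (congrArg Subtype.val h0), fun g => Subtype.ext (hf g),
    fun a ha => Subtype.ext (hp a ha)⟩

theorem HasFixed.isLocallyFinite (h : HasFixed G p I 0) : IsLocallyFinite G := by
  obtain ⟨E, _, _, hK, hS, hE, ⟨⟨-, hr⟩, -⟩, e, he, hf, hp⟩ := h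
  classical
  rintro H ⟨T, hT⟩
  by_contra hH
  rw [not_finite_iff_infinite] at hH
  refine he (eq_zero_of_addChar (fun c => ?_))
  let R := MonoidAlgebra A G
  let Y := T → Rᵐᵒᵖ ⧸ extIdeal Rᵐᵒᵖ I
  let d : T → Rᵐᵒᵖ := fun t => MulOpposite.op (MonoidAlgebra.single t.1 1 - 1)
  have hY : Killed Rᵐᵒᵖ I Y := fun a ha y => funext fun t => killed_quotient_extIdeal a ha (y t)
  -- The tuple `(t - 1)`, for `t` in the generating set `T` of the infinite group `H`, has
  -- annihilator inside `I B`. Flatness therefore extends any character `c` of `E` to `f` on `Y`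
  -- with value `c` at this tuple, so `c e` is a sum of characters evaluated at `(t - 1) e = 0`.
  obtain ⟨f, hfc⟩ := hr.exists_apply_eq hY (fun t => Submodule.Quotient.mk (d t))
    (show RChar R E from c) (fun b hb => by
      have hb' : b.unop ∈ I • (⊤ : Submodule A R) := by
        refine coeff_mem_of_invariant hT (fun t ht => ?_)
        have := congrFun hb ⟨t, ht⟩
        rw [Pi.smul_apply, ← Submodule.Quotient.mk_smul, Pi.zero_apply,
          Submodule.Quotient.mk_eq_zero, mem_extIdeal, op_mem_smul_top] at this
        exact this
      ext m
      rw [RChar.smul_apply, hK.smul_eq_zero hb', map_zero, RChar.zero_apply])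
  have hsum : (fun t => Submodule.Quotient.mk (d t) : Y) =
      ∑ t : T, d t • (Pi.single t (Submodule.Quotient.mk 1) : Y) := by
    funext t
    rw [Finset.sum_apply, Finset.sum_eq_single t]
    · rw [Pi.smul_apply, Pi.single_eq_same, ← Submodule.Quotient.mk_smul, smul_eq_mul, mul_one]
    · intro t' _ ht'
      rw [Pi.smul_apply, Pi.single_eq_of_ne (Ne.symm ht'), smul_zero]
    · simp
  change (show RChar R E from c) e = 0
  rw [← hfc, hsum, map_sum]
  have : ∀ t : T, (f (d t • (Pi.single t (Submodule.Quotient.mk 1) : Y))) e = 0 := fun t => by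
    rw [f.map_smul, RChar.smul_apply, MulOpposite.unop_op, sub_smul, hf, one_smul, sub_self,
      map_zero]
  let ev : RChar R E →+ AddCircle (1 : ℚ) := ⟨⟨fun c => c e, rfl⟩, fun _ _ => rfl⟩
  change ev (∑ t : T, f (d t • (Pi.single t (Submodule.Quotient.mk 1) : Y))) = 0
  rw [map_sum]
  exact Finset.sum_eq_zero (fun t _ => this t)

theorem sLoc_characterModule_localization :
    SLoc A p.primeCompl (CharacterModule (Localization.AtPrime p)) := by
  intro s hs
  let u := IsLocalization.map_units (Localization.AtPrime p) (⟨s, hs⟩ : p.primeCompl)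
  have hb : Function.Bijective (cmul A (Localization.AtPrime p) s) := by
    have : ⇑(cmul A (Localization.AtPrime p) s) = fun m => u.unit • m := by
      ext m
      simp [Algebra.smul_def, Units.smul_def]
    rw [this]
    exact MulAction.bijective u.unit
  exact CharacterModule.dual_bijective_iff_bijective.2 hb

/-- A nonzero character of the residue field, pulled back to the local ring, is killed by `p`. -/
theorem exists_character_localization :
    ∃ c : CharacterModule (Localization.AtPrime p), c ≠ 0 ∧ ∀ a ∈ p, a • c = 0 := by
  obtain ⟨c, hc⟩ := CharacterModule.exists_character_apply_ne_zero_of_ne_zero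
    (one_ne_zero (α := IsLocalRing.ResidueField (Localization.AtPrime p)))
  let c' : CharacterModule (Localization.AtPrime p) := AddMonoidHom.comp c
    (IsLocalRing.residue (Localization.AtPrime p)).toAddMonoidHom
  refine ⟨c', fun h => hc ?_, fun a ha => ?_⟩
  · have : c' 1 = 0 := by rw [h]; rfl
    rw [← map_one (IsLocalRing.residue (Localization.AtPrime p))]
    exact this
  · ext m
    change c (IsLocalRing.residue _ (a • m)) = 0
    have : a • m ∈ IsLocalRing.maximalIdeal (Localization.AtPrime p) := by
      rw [Algebra.smul_def]
      refine Ideal.mul_mem_right _ _ ?_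
      exact (IsLocalization.AtPrime.to_map_mem_maximal_iff (Localization.AtPrime p) p a).2 ha
    rw [(IsLocalRing.residue_eq_zero_iff _).2 this, map_zero]

theorem HasFixed.of_flatDimLE {n : ℕ}
    (h : ∀ (E : Type u) [AddCommGroup E] [Module (MonoidAlgebra A G) E],
      Module.Injective (MonoidAlgebra A G) E → FlatDimLE (MonoidAlgebra A G) n E) :
    HasFixed G p (⊥ : Ideal A) n := by
  have hW : Module.Injective A (CharacterModule (Localization.AtPrime p)) :=
    Module.Flat.iff_characterModule_injective.1 (IsLocalization.flat _ p.primeCompl)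
  have hE := Coind.injective (B := MonoidAlgebra A G) hW
  have hS : SLoc (MonoidAlgebra A G) p.primeCompl
      (Coind (A := A) (MonoidAlgebra A G) (CharacterModule (Localization.AtPrime p))) :=
    Coind.sLoc sLoc_characterModule_localization
  obtain ⟨w, hw, hpw⟩ := exists_character_localization (p := p)
  -- The augmentation is unchanged under multiplication by group elements, so `b ↦ ε b • w` is
  -- `G`-fixed. It takes the value `w ≠ 0` at `1`.
  let ε : MonoidAlgebra A G →ₐ[A] A := MonoidAlgebra.lift A A G 1
  let e : Coind (A := A) (MonoidAlgebra A G) (CharacterModule (Localization.AtPrime p)) :=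
    LinearMap.toSpanSingleton A _ w ∘ₗ ε.toLinearMap
  have he : ∀ b, e b = ε b • w := fun b => rfl
  refine ⟨_, _, _, killed_bot, hS, rInj_bot_iff.2 hE,
    -- The coinduced module is its own localization at `p`, so localizing its flat resolution again
    -- resolves it.
    hS.isLoc_id.res (fun q hq hM => hq.lFlat (isFlat_iff_rFlat_bot.1 hM)) n
      ((flatDimLE_iff_res n _).1 (h _ hE)), e, fun h0 => hw ?_, fun g => ?_, fun a ha => ?_⟩
  · have := DFunLike.congr_fun h0 1
    rwa [he, map_one, one_smul] at this
  · ext1 b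
    rw [Coind.smul_apply, he, he, map_mul]
    simp [ε]
  · ext1 b
    rw [Coind.algebraMap_smul_apply, he, smul_comm, hpw a ha, smul_zero, Coind.zero_apply]

end GroupAlgebra

/-! ### Commutative rings -/

section Commutative

variable {A : Type u} [CommRing A] {I : Ideal A} {S : Submonoid A} {x : A}

section

variable {M : Type u} [AddCommGroup M] [Module A M]

attribute [local instance] RingHomInvPair.of_ringEquiv in
theorem isFlat_iff_flat : IsFlat A M ↔ Module.Flat A M := by
  rw [isFlat_iff_injective_rChar, Module.Flat.iff_characterModule_injective]
  let e : A ≃+* Aᵐᵒᵖ := RingEquiv.toOpposite A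
  let f : CharacterModule M ≃ₛₗ[RingHomClass.toRingHom e] RChar A M :=
    { toFun := fun c => c
      map_add' := fun _ _ => rfl
      map_smul' := fun _ _ => rfl
      invFun := fun c => c
      left_inv := fun _ => rfl
      right_inv := fun _ => rfl }
  exact ⟨fun _ => Module.Injective.of_ringEquiv e.symm f.symm,
    fun _ => Module.Injective.of_ringEquiv e f⟩

theorem map_mem_ideal_smul_top {N : Type u} [AddCommGroup N] [Module A N] (f : M →ₗ[A] N)
    {J : Ideal A} {m : M} (hm : m ∈ J • (⊤ : Submodule A M)) :
    f m ∈ J • (⊤ : Submodule A N) := by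
  have := Submodule.mem_map_of_mem (f := f) hm
  rw [Submodule.map_smul''] at this
  exact Submodule.smul_mono le_rfl le_top this

/-- Flatness gives `(J M : a) ⊆ (J : a) M`. Indeed, a character `c` vanishing on `K M` defines a map
`a ↦ c` on the submodule of `A ⧸ J` generated by `a`; an extension `f` to `A ⧸ J` satisfies `c = a •
f 1`, and `f 1` vanishes on `J M`. -/
theorem RFlat.mem_smul_top (hM : RFlat A I M) {J K : Ideal A} (hIJ : I ≤ J) {a : A}
    (hK : ∀ b, a * b ∈ J → b ∈ K) {z : M} (hz : a • z ∈ J • (⊤ : Submodule A M)) :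
    z ∈ K • (⊤ : Submodule A M) := by
  refine mem_of_addChar (T := (K • (⊤ : Submodule A M)).toAddSubgroup) (fun c hc => ?_)
  have hY : Killed Aᵐᵒᵖ I (Aᵐᵒᵖ ⧸ extIdeal Aᵐᵒᵖ J) := killed_quotient_extIdeal.mono hIJ
  obtain ⟨f, hf⟩ := hM.2.exists_apply_eq hY (Submodule.Quotient.mk (MulOpposite.op a))
    (show RChar A M from c) (fun b hb => by
      rw [← Submodule.Quotient.mk_smul, Submodule.Quotient.mk_eq_zero, mem_extIdeal,
        op_mem_smul_top, smul_eq_mul, Ideal.mul_top] at hb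
      ext m
      exact hc _ (Submodule.smul_mem_smul (hK b.unop hb) trivial))
  have hop : ∀ r : A, f (Submodule.Quotient.mk (MulOpposite.op r)) =
      MulOpposite.op r • f (Submodule.Quotient.mk 1) := fun r => by
    rw [← f.map_smul, ← Submodule.Quotient.mk_smul, smul_eq_mul, mul_one]
  have hJ : ∀ w ∈ J • (⊤ : Submodule A M), f (Submodule.Quotient.mk 1) w = 0 := by
    intro w hw
    induction hw using Submodule.smul_induction_on' with
    | smul j hj m _ =>
      have h0 : (Submodule.Quotient.mk (MulOpposite.op j) : Aᵐᵒᵖ ⧸ extIdeal Aᵐᵒᵖ J) = 0 := by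
        rw [Submodule.Quotient.mk_eq_zero, mem_extIdeal, op_mem_smul_top, smul_eq_mul,
          Ideal.mul_top]
        exact hj
      have := DFunLike.congr_fun (hop j) m
      rw [h0, map_zero] at this
      exact this.symm
    | add v _ w _ hv hw => rw [map_add, hv, hw, add_zero]
  change (show RChar A M from c) z = 0
  rw [← hf, hop]
  exact hJ _ hz

/-- A quotient of a flat module by a submodule meeting the `J`-multiples only in `J`-multiples is
flat. -/
theorem isFlat_of_forall_ideal {F : Type u} [AddCommGroup F] [Module A F] (hF : IsFlat A F)
    (π : F →ₗ[A] M) (hπ : Function.Surjective π)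
    (h : ∀ (J : Ideal A) (z : LinearMap.ker π), z.1 ∈ J • (⊤ : Submodule A F) →
      z ∈ J • (⊤ : Submodule A (LinearMap.ker π))) : IsFlat A M := by
  rw [isFlat_iff_flat, Module.Flat.iff_characterModule_baer]
  rw [isFlat_iff_flat, Module.Flat.iff_characterModule_baer] at hF
  -- Baer's criterion for `M⁺`. Injectivity of `F⁺` gives a character `c` of `F` that represents `g`
  -- on `J`. It vanishes on `ker π ∩ J F = J ker π`, so some `c₃` killing `J F` agrees with `c` on
  -- `ker π`, and `c - c₃` descends to the required character of `M`.
  intro J g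
  obtain ⟨g', hg'⟩ := hF J (CharacterModule.dual π ∘ₗ g)
  let c : RChar A F := show F →+ AddCircle (1 : ℚ) from g' 1
  have hc : ∀ (j : A) (hj : j ∈ J) (f : F), c (j • f) = g ⟨j, hj⟩ (π f) := fun j hj f => by
    have h₁ : g' j = j • g' 1 := by rw [← g'.map_smul, smul_eq_mul, mul_one]
    have h₂ := DFunLike.congr_fun (h₁.symm.trans (hg' j hj)) f
    exact h₂
  let τ : LinearMap.ker π →ₗ[A] F ⧸ J • (⊤ : Submodule A F) :=
    (J • (⊤ : Submodule A F)).mkQ ∘ₗ (LinearMap.ker π).subtype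
  obtain ⟨c₁, hc₁⟩ := RChar.exists_map_eq τ.rangeRestrict τ.surjective_rangeRestrict
    (RChar.map (LinearMap.ker π).subtype c) (fun z hz => by
      have hz' : z.1 ∈ J • (⊤ : Submodule A F) := by
        rw [← Submodule.Quotient.mk_eq_zero]
        exact congrArg Subtype.val hz
      have := h J z hz'
      clear hz hz'
      induction this using Submodule.smul_induction_on' with
      | smul j hj k _ =>
        refine (hc j hj k.1).trans ?_
        rw [show π k.1 = 0 from k.2]
        exact map_zero _
      | add v _ w _ hv hw => rw [map_add, hv, hw, add_zero])
  obtain ⟨c₂, rfl⟩ := RChar.map_surjective (LinearMap.range τ).subtype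
    (Submodule.injective_subtype _) c₁
  let c₃ : RChar A F := RChar.map (J • (⊤ : Submodule A F)).mkQ c₂
  have hc₃ : ∀ z, π z = 0 → c₃ z = c z := fun z hz => DFunLike.congr_fun hc₁ ⟨z, hz⟩
  have hc₃' : ∀ j ∈ J, ∀ f : F, c₃ (j • f) = 0 := fun j hj f => by
    change c₂ (Submodule.Quotient.mk (j • f)) = 0
    rw [(Submodule.Quotient.mk_eq_zero (J • ⊤)).2 (Submodule.smul_mem_smul hj Submodule.mem_top),
      map_zero]
  obtain ⟨d, hd⟩ := RChar.exists_map_eq π hπ (c - c₃) (fun z hz => by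
    rw [RChar.sub_apply, hc₃ z hz, sub_self])
  refine ⟨LinearMap.toSpanSingleton A _ (show CharacterModule M from d), fun j hj => ?_⟩
  ext m
  obtain ⟨f, rfl⟩ := hπ m
  change d (j • π f) = _
  rw [← π.map_smul, ← RChar.map_apply, hd, RChar.sub_apply, hc₃' j hj, sub_zero, hc j hj]

/-- `M = F ⧸ K` with `F` and `K` in `𝓕`, and `p F ∩ K` is not contained in `p K`, even after
localization at `p`. -/
def TorWitness (𝓕 : ∀ (M : Type u) [AddCommGroup M] [Module A M], Prop) (p : Ideal A)
    (M : Type u) [AddCommGroup M] [Module A M] : Prop :=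
  ∃ (F : Type u) (_ : AddCommGroup F) (_ : Module A F) (π : F →ₗ[A] M),
    𝓕 F ∧ Function.Surjective π ∧ 𝓕 (LinearMap.ker π) ∧
    ∃ z : LinearMap.ker π, z.1 ∈ p • (⊤ : Submodule A F) ∧
      ∀ s ∉ p, s • z ∉ p • (⊤ : Submodule A (LinearMap.ker π))

/-- Non-flatness means `ker π ∩ J F ⊄ J ker π` for some `J`, that is, `Tor₁(A/J, M) ≠ 0`. A maximal
such `J` exists since `A` is Noetherian, and it is prime. Flatness of `ker π` shows that the
obstruction survives multiplication by `s ∉ J`. -/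
theorem exists_torWitness [IsNoetherianRing A] {F : Type u} [AddCommGroup F] [Module A F]
    (hF : IsFlat A F) (π : F →ₗ[A] M) (hπ : Function.Surjective π)
    (hK : IsFlat A (LinearMap.ker π)) (hM : ¬ IsFlat A M) :
    ∃ p : PrimeSpectrum A, TorWitness (IsFlat A) p.asIdeal M := by
  let P : Set (Ideal A) := {J | ∃ z : LinearMap.ker π, z.1 ∈ J • (⊤ : Submodule A F) ∧
    z ∉ J • (⊤ : Submodule A (LinearMap.ker π))}
  have hP : P.Nonempty := by
    by_contra hP
    refine hM (isFlat_of_forall_ideal hF π hπ (fun J z hz => ?_))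
    by_contra hz'
    exact hP ⟨J, z, hz, hz'⟩
  obtain ⟨J, ⟨z, hz, hz'⟩, hmax⟩ := set_has_maximal_iff_noetherian.2 ‹IsNoetherianRing A› P hP
  have hF' := isFlat_iff_rFlat_bot (A := A).1 hF
  have hK' := isFlat_iff_rFlat_bot (A := A).1 hK
  have hlt : ∀ J' : Ideal A, J < J' → ∀ w : LinearMap.ker π, w.1 ∈ J' • (⊤ : Submodule A F) →
      w ∈ J' • (⊤ : Submodule A (LinearMap.ker π)) := fun J' hJ w hw => by
    by_contra hw'
    exact hmax J' ⟨w, hw, hw'⟩ hJ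
  have hprime : Ideal.IsPrime J := by
    refine ⟨fun h => hz' ?_, fun {a b} hab => ?_⟩
    · rw [h, Submodule.top_smul]; exact Submodule.mem_top
    · by_contra! hnot
      obtain ⟨ha, hb⟩ := hnot
      -- Both `J + (a)` and `C = (J : a)` strictly contain `J`. Maximality gives `z = w + a k` with
      -- `w ∈ J ker π`. Then `a k ∈ J F`, so `k ∈ C F` by flatness, `k ∈ C ker π` by maximality, and
      -- `a k ∈ J ker π`: a contradiction.
      let C : Ideal A := Submodule.comap (LinearMap.mulLeft A a) J
      have hJC : J < C := lt_of_le_of_ne (fun j hj => Ideal.mul_mem_left J _ hj) (fun h => hb (by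
        rw [h]; exact hab))
      have hJa : J < J ⊔ Ideal.span {a} := lt_of_le_of_ne le_sup_left (fun h => ha (by
        rw [h]; exact Ideal.mem_sup_right (Ideal.mem_span_singleton_self a)))
      have h₁ := hlt _ hJa z (Submodule.smul_mono_left le_sup_left hz)
      rw [Submodule.sup_smul] at h₁
      obtain ⟨w, hw, v, hv, hwv⟩ := Submodule.mem_sup.1 h₁
      rw [Submodule.ideal_span_singleton_smul] at hv
      obtain ⟨k, -, rfl⟩ := hv
      have h₂ : a • k.1 ∈ J • (⊤ : Submodule A F) := by
        have e : a • k.1 = z.1 - w.1 := by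
          rw [← hwv]
          simp
        rw [e]
        refine sub_mem hz ?_
        exact map_mem_ideal_smul_top (LinearMap.ker π).subtype hw
      have h₃ : k ∈ C • (⊤ : Submodule A (LinearMap.ker π)) :=
        hlt C hJC k (hF'.mem_smul_top bot_le (K := C) (fun b hb => hb) h₂)
      have h₄ : a • k ∈ J • (⊤ : Submodule A (LinearMap.ker π)) := by
        clear hwv h₂
        induction h₃ using Submodule.smul_induction_on' with
        | smul c hc m _ =>
          rw [← mul_smul]
          exact Submodule.smul_mem_smul hc trivial
        | add v _ w _ hv hw => rw [smul_add]; exact add_mem hv hw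
      refine hz' ?_
      rw [← hwv]
      exact add_mem hw h₄
  refine ⟨⟨J, hprime⟩, F, _, _, π, hF, hπ, hK, z, hz, fun s hs h => hz' ?_⟩
  exact hK'.mem_smul_top bot_le (fun b hb => (hprime.mem_or_mem hb).resolve_left hs) h

/-- The `n`-th syzygy is a quotient of a flat module by a flat submodule, but is not flat itself, so
it carries a `Tor₁` obstruction. -/
theorem exists_res_torWitness [IsNoetherianRing A] (n : ℕ) {M : Type u} [AddCommGroup M]
    [Module A M] (h : FlatDimLE A (n + 1) M) (h' : ¬ FlatDimLE A n M) :
    ∃ p : PrimeSpectrum A, Res (IsFlat A) (TorWitness (IsFlat A) p.asIdeal) n M := by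
  rw [flatDimLE_iff_res] at h h'
  refine Res.exists (𝓠 := fun p : PrimeSpectrum A => TorWitness (IsFlat A) p.asIdeal) n ?_
  induction n generalizing M with
  | zero =>
    obtain ⟨F, _, _, π, hF, hπ, hK⟩ := h
    exact exists_torWitness hF π hπ hK h'
  | succ n ih =>
    obtain ⟨F, _, _, π, hF, hπ, hK⟩ := h
    exact ⟨F, _, _, π, hF, hπ, ih hK (fun hK' => h' ⟨F, _, _, π, hF, hπ, hK'⟩)⟩

end

/-! ### Obstructions at a prime under localization and reduction -/

variable {M N : Type u} [AddCommGroup M] [Module A M] [AddCommGroup N] [Module A N]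
  {p : Ideal A}

theorem TorWitness.of_isLoc [p.IsPrime] {q : M →ₗ[A] N} (hq : IsLoc p.primeCompl q)
    (h : TorWitness (IsFlat A) p M) : TorWitness (LFlat A (⊥ : Ideal A) p.primeCompl) p N := by
  obtain ⟨F, _, _, π, hF, hπ, hK, z, hz, hz'⟩ := h
  obtain ⟨F', _, _, qF, hqF⟩ := exists_isLoc (B := A) p.primeCompl F
  obtain ⟨π', hπ', qK, hqK, hqKF⟩ := IsLoc.exists_ker π qF q hπ hqF hq
  refine ⟨F', _, _, π', hqF.lFlat (isFlat_iff_rFlat_bot.1 hF), hπ',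
    hqK.lFlat (isFlat_iff_rFlat_bot.1 hK), qK z, ?_, fun s hs hmem => ?_⟩
  · rw [hqKF]
    exact map_mem_ideal_smul_top _ hz
  -- Clearing denominators would put a multiple of `z` by an element outside `p` into `p ker π`. The
  -- quantifier over `s` in `TorWitness` excludes this.
  · have key : ∀ n ∈ p • (⊤ : Submodule A (LinearMap.ker π')), ∃ t ∈ p.primeCompl,
        ∃ k ∈ p • (⊤ : Submodule A (LinearMap.ker π)), t • n = qK k := by
      intro n hn
      induction hn using Submodule.smul_induction_on' with
      | smul a ha n _ =>
        obtain ⟨t, ht, k, hk⟩ := hqK.2.2 n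
        refine ⟨t, ht, a • k, Submodule.smul_mem_smul ha trivial, ?_⟩
        rw [qK.map_smul, ← hk, smul_comm]; rfl
      | add v _ w _ hv hw =>
        obtain ⟨t, ht, k, hk, e⟩ := hv
        obtain ⟨t', ht', k', hk', e'⟩ := hw
        refine ⟨t * t', mul_mem ht ht', t' • k + t • k',
          add_mem (Submodule.smul_mem _ _ hk) (Submodule.smul_mem _ _ hk'), ?_⟩
        rw [map_add, qK.map_smul, qK.map_smul, ← e, ← e', smul_add, mul_smul, mul_smul,
          smul_comm t t' v]
    obtain ⟨t, ht, k, hk, e⟩ := key _ hmem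
    obtain ⟨r, hr, h0⟩ := hqK.2.1 (t • s • z - k) (by
      rw [map_sub, qK.map_smul, qK.map_smul, e, sub_self])
    refine hz' (r * t * s) (mul_mem (mul_mem hr ht) hs) ?_
    change r • (t • s • z - k) = 0 at h0
    rw [smul_sub, sub_eq_zero] at h0
    rw [mul_smul, mul_smul, h0]
    exact Submodule.smul_mem _ _ hk

theorem TorWitness.of_isReduction {q : M →ₗ[A] N} (hq : IsReduction x q)
    (hx : RegularMod A I S x) (hxp : x ∈ p) (h : TorWitness (LFlat A I S) p M) :
    TorWitness (LFlat A (I ⊔ Ideal.span {x}) S) p N := by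
  obtain ⟨F, _, _, π, hF, hπ, hK, z, hz, hz'⟩ := h
  have hqF := isReduction_mkQ (hF.injective_smul hx)
  obtain ⟨π', hπ', qK, hqK, hqKF⟩ := IsReduction.exists_ker π _ q hπ hqF hq
  refine ⟨_, _, _, π', hqF.lFlat hF, hπ', hqK.lFlat hK, qK z, ?_, fun s hs hmem => hz' s hs ?_⟩
  · rw [hqKF]
    exact map_mem_ideal_smul_top _ hz
  · have hmap : Submodule.map qK (p • ⊤) = p • ⊤ := by
      rw [Submodule.map_smul'', Submodule.map_top, LinearMap.range_eq_top.2 hqK.2.1]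
    rw [← hmap, ← qK.map_smul] at hmem
    obtain ⟨k, hk, e⟩ := hmem
    obtain ⟨k', hk'⟩ := (hqK.2.2 (s • z - k)).1 (by rw [map_sub, e, sub_self])
    have : s • z = x • k' + k := by
      rw [← sub_eq_iff_eq_add, ← hk']; rfl
    rw [this]
    exact add_mem (Submodule.smul_mem_smul hxp trivial) hk

/-- A homological obstruction at `p` produces a nonzerodivisor in `p`. -/
theorem TorWitness.exists_regularMod [IsNoetherianRing A] [p.IsPrime]
    (h : TorWitness (LFlat A I p.primeCompl) p M) : ∃ x ∈ p, RegularMod A I p.primeCompl x := by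
  obtain ⟨F, _, _, π, hF, hπ, hK, z, hz, hz'⟩ := h
  by_contra! hno
  -- The contraction to `A` of the extension of `I` to the localization at `p`. By `hno`, every
  -- element of `p` is a zero divisor modulo `I'`.
  let I' : Ideal A :=
    { carrier := {a | ∃ s ∈ p.primeCompl, s * a ∈ I}
      add_mem' := by
        rintro a b ⟨s, hs, ha⟩ ⟨t, ht, hb⟩
        refine ⟨s * t, mul_mem hs ht, ?_⟩
        rw [mul_add]
        refine I.add_mem ?_ ?_
        · rw [mul_right_comm]; exact I.mul_mem_right _ ha
        · rw [mul_assoc]; exact I.mul_mem_left _ hb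
      zero_mem' := ⟨1, one_mem _, by simp⟩
      smul_mem' := by
        rintro c a ⟨s, hs, ha⟩
        refine ⟨s, hs, ?_⟩
        rw [smul_eq_mul, mul_left_comm]
        exact I.mul_mem_left _ ha }
  have hII' : I ≤ I' := fun a ha => ⟨1, one_mem _, by simpa using ha⟩
  have hdisj : Disjoint ((p.map (Ideal.Quotient.mk I') : Ideal (A ⧸ I')) : Set (A ⧸ I'))
      (nonZeroDivisors (A ⧸ I')) := by
    rw [Set.disjoint_left]
    intro y hy hy'
    obtain ⟨y, hyp, rfl⟩ := (Ideal.mem_map_iff_of_surjective _ Ideal.Quotient.mk_surjective).1 hy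
    have := hno y hyp
    rw [regularMod_self_iff] at this
    push Not at this
    obtain ⟨b, hyb, hb⟩ := this
    have h0 : Ideal.Quotient.mk I' b = 0 :=
      (mem_nonZeroDivisors_iff_right.1 hy') _ (by
        rw [← map_mul, mul_comm, Ideal.Quotient.eq_zero_iff_mem]
        exact hII' hyb)
    rw [Ideal.Quotient.eq_zero_iff_mem] at h0
    obtain ⟨s, hs, hsb⟩ := h0
    exact hb s hs hsb
  -- In a Noetherian ring, an ideal consisting of zero divisors has a nonzero annihilator; so `s p ⊆
  -- I'` for some `s ∉ I'`.
  obtain ⟨-, s, hs, hs0⟩ := SetLike.lt_iff_le_and_exists.1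
    (Ideal.bot_lt_annihilator_of_disjoint_nonZeroDivisors hdisj)
  obtain ⟨s, rfl⟩ := Ideal.Quotient.mk_surjective s
  rw [Submodule.mem_annihilator] at hs
  have hsp : ∀ y ∈ p, s * y ∈ I' := fun y hy => by
    have := hs _ (Ideal.mem_map_of_mem _ hy)
    rwa [smul_eq_mul, ← map_mul, Ideal.Quotient.eq_zero_iff_mem] at this
  have hs0 : s ∉ I' := fun h => hs0 (by
    rw [Ideal.mem_bot, Ideal.Quotient.eq_zero_iff_mem]; exact h)
  have hsF : ∀ w ∈ p • (⊤ : Submodule A F), s • w = 0 := by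
    intro w hw
    induction hw using Submodule.smul_induction_on' with
    | smul y hy f _ =>
      obtain ⟨t, ht, h⟩ := hsp y hy
      refine (hF.2 t ht).1 ?_
      change t • s • y • f = t • 0
      rw [smul_zero, ← mul_smul, ← mul_smul, mul_assoc]
      exact hF.1.1 _ h f
    | add v _ w _ hv hw => rw [smul_add, hv, hw, add_zero]
  have hsz : s • z = 0 := Subtype.ext (hsF _ hz)
  -- From `z ∈ p F` follows `s z = 0`. Flatness of `ker π` and `(I' : s) ⊆ p` then give `z ∈ p ker
  -- π`, against the choice of `z`.
  refine hz' 1 (fun h => (‹p.IsPrime›.ne_top ((Ideal.eq_top_iff_one p).2 h))) ?_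
  rw [one_smul]
  refine hK.1.mem_smul_top hII' (a := s) (fun b hb => ?_) (by rw [hsz]; exact zero_mem _)
  by_contra hbp
  obtain ⟨t, ht, h⟩ := hb
  exact hs0 ⟨t * b, mul_mem ht hbp, by rwa [mul_assoc, mul_comm b s]⟩

theorem Res.exists_last {B : Type u} [Ring B]
    {𝓕 𝓠 : ∀ (M : Type u) [AddCommGroup M] [Module B M], Prop} (n : ℕ) {M : Type u}
    [AddCommGroup M] [Module B M] (h : Res 𝓕 𝓠 n M) :
    ∃ (M' : Type u) (_ : AddCommGroup M') (_ : Module B M'), 𝓠 M' := by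
  induction n generalizing M with
  | zero => exact ⟨M, _, _, h⟩
  | succ n ih =>
    obtain ⟨F, _, _, π, -, -, hK⟩ := h
    exact ih hK

/-- Each round takes a regular `x ∈ p` from the obstruction at the last syzygy and adds it to `I`.
As `x` may fail to be regular on `M`, a further round reduces the first syzygy instead, where `x` is
regular inside a flat module. There are `n + 1` rounds, exactly using up the index of `HasFixed`. -/
theorem isLocallyFinite_of_res_torWitness [IsNoetherianRing A] [p.IsPrime] {G : Type u} [Group G]
    (n : ℕ) {I : Ideal A} {M : Type u} [AddCommGroup M] [Module A M]
    (h : Res (LFlat A I p.primeCompl) (TorWitness (LFlat A I p.primeCompl) p) n M)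
    (hG : HasFixed G p I (n + 1)) : IsLocallyFinite G := by
  induction n generalizing I M with
  | zero =>
    obtain ⟨x, hxp, hx⟩ := TorWitness.exists_regularMod h
    exact (hG.reduce hxp hx).isLocallyFinite
  | succ n ih =>
    obtain ⟨M', _, _, hM'⟩ := h.exists_last
    obtain ⟨x, hxp, hx⟩ := TorWitness.exists_regularMod hM'
    obtain ⟨F, _, _, π, hF, hπ, hK⟩ := h
    have hKx : Function.Injective (cmul A (LinearMap.ker π) x) := fun k k' h =>
      Subtype.ext (hF.injective_smul hx (congrArg Subtype.val h))
    exact ih ((isReduction_mkQ hKx).res hx (fun q hq hM => hM.of_isReduction hq hx hxp) n hK)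
      (hG.reduce hxp hx)

/-- If the flat dimensions of injective modules over the group algebra do not exceed a flat
dimension attained over the coefficient ring, then the group is locally finite. -/
theorem isLocallyFinite_of_flatDimLE [IsNoetherianRing A] [Nontrivial A] {G : Type u} [Group G]
    (n : ℕ) (hn : n ≠ 0 → ∃ (M : Type u) (_ : AddCommGroup M) (_ : Module A M),
      FlatDimLE A n M ∧ ¬ FlatDimLE A (n - 1) M)
    (hG : ∀ (E : Type u) [AddCommGroup E] [Module (MonoidAlgebra A G) E],
      Module.Injective (MonoidAlgebra A G) E → FlatDimLE (MonoidAlgebra A G) n E) :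
    IsLocallyFinite G := by
  cases n with
  | zero =>
    -- No obstruction is needed in dimension zero: any prime will do.
    obtain ⟨m, hm⟩ := Ideal.exists_maximal A
    have := hm.isPrime
    exact (HasFixed.of_flatDimLE (p := m) hG).isLocallyFinite
  | succ n =>
    obtain ⟨M, _, _, h, h'⟩ := hn n.succ_ne_zero
    obtain ⟨⟨p, hp⟩, hM⟩ := exists_res_torWitness n h h'
    obtain ⟨N, _, _, q, hq⟩ := exists_isLoc (B := A) p.primeCompl M
    exact isLocallyFinite_of_res_torWitness (p := p) n
      (hq.res (fun q hq hM => hM.of_isLoc hq) n hM) (HasFixed.of_flatDimLE hG)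

end Commutative

open CategoryTheory Abelian Limits

/-! ### Flat, projective and injective dimension -/

section Dimension

variable {R : Type u} [Ring R] {M : Type u} [AddCommGroup M] [Module R M]

theorem IsFlat.ker {R : Type u} [Ring R] {M N : Type u} [AddCommGroup M] [Module R M]
    [AddCommGroup N] [Module R N] (hM : IsFlat R M) (hN : IsFlat R N) (p : M →ₗ[R] N)
    (hp : Function.Surjective p) : IsFlat R (LinearMap.ker p) := by
  rw [isFlat_iff_rFlat_bot (A := Subring.center R)] at hM hN ⊢
  exact hM.ker hN p hp

theorem exists_projective_cover (R : Type u) [Ring R] (M : Type u) [AddCommGroup M] [Module R M] :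
    ∃ (P : Type u) (_ : AddCommGroup P) (_ : Module R P) (p : P →ₗ[R] M),
      IsFlat R P ∧ Projective (ModuleCat.of R P) ∧ Function.Surjective p :=
  ⟨M →₀ R, _, _, Finsupp.linearCombination R id, IsFlat.of_projective inferInstance,
    (IsProjective.iff_projective (R := R) (M →₀ R)).1 inferInstance,
    Finsupp.linearCombination_id_surjective R M⟩

theorem FlatDimLE.succ {n : ℕ} (h : FlatDimLE R n M) : FlatDimLE R (n + 1) M := by
  rw [flatDimLE_iff_res] at h ⊢
  exact Res.succ (fun M N _ _ _ _ p hp hM hN => hM.ker hN p hp) n h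

theorem FlatDimLE.mono {m n : ℕ} (hmn : m ≤ n) (h : FlatDimLE R m M) : FlatDimLE R n M := by
  induction hmn with
  | refl => exact h
  | step _ ih => exact ih.succ

theorem flatDim_le_iff {n : ℕ} : flatDim R M ≤ n ↔ FlatDimLE R n M := by
  refine ⟨fun h => ?_, fun h => iInf₂_le n h⟩
  have h' : flatDim R M < (n + 1 : ℕ) := lt_of_le_of_lt h (by exact_mod_cast n.lt_succ_self)
  simp only [flatDim, iInf_lt_iff] at h'
  obtain ⟨m, hm, hmn⟩ := h'
  exact hm.mono (Nat.lt_succ_iff.1 (by exact_mod_cast hmn))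

theorem sfli_le_iff {n : ℕ} : sfli R ≤ n ↔ ∀ (E : Type u) [AddCommGroup E] [Module R E],
    Module.Injective R E → FlatDimLE R n E := by
  simp only [sfli, iSup_le_iff, flatDim_le_iff]
  exact ⟨fun h E _ _ hE => h (ModuleCat.of R E) hE, fun h E hE => h E hE⟩

theorem spli_le_iff {n : ℕ} : spli R ≤ n ↔ ∀ (E : Type u) [AddCommGroup E] [Module R E],
    Module.Injective R E → HasProjectiveDimensionLT (ModuleCat.of R E) (n + 1) := by
  simp only [spli, iSup_le_iff]
  constructor
  · intro h E _ _ hE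
    exact (projectiveDimension_le_iff _ n).1 (h (ModuleCat.of R E) hE)
  · intro h E hE
    exact (projectiveDimension_le_iff E n).2 (h E hE)

theorem FlatDimLE.of_hasProjectiveDimensionLT (n : ℕ)
    (h : HasProjectiveDimensionLT (ModuleCat.of R M) (n + 1)) : FlatDimLE R n M := by
  induction n generalizing M with
  | zero =>
    refine IsFlat.of_projective ?_
    rw [IsProjective.iff_projective]
    infer_instance
  | succ n ih =>
    obtain ⟨P, _, _, p, hPf, hP, hp⟩ := exists_projective_cover R M
    exact ⟨P, _, _, p, hPf, hp, ih (((LinearMap.shortExact_shortComplexKer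
      hp).hasProjectiveDimensionLT_X₃_iff n hP).1 h)⟩

theorem sfli_le_of_spli_le {n : ℕ} (h : spli R ≤ n) : sfli R ≤ n :=
  sfli_le_iff.2 (fun _ _ _ hE => .of_hasProjectiveDimensionLT n (spli_le_iff.1 h _ hE))

end Dimension

/-! ### Character modules: injective dimension and purity -/

section Commutative

variable {A : Type u} [CommRing A] {M : Type u} [AddCommGroup M] [Module A M]

/-- Taking characters turns a flat resolution of `M` into an injective resolution of `M⁺`. -/
theorem hasInjectiveDimensionLT_characterModule (n : ℕ) (h : FlatDimLE A n M) :
    HasInjectiveDimensionLT (ModuleCat.of A (CharacterModule M)) (n + 1) := by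
  have key : ∀ {F : Type u} [AddCommGroup F] [Module A F], IsFlat A F →
      Injective (ModuleCat.of A (CharacterModule F)) := fun hF => by
    rw [isFlat_iff_flat, Module.Flat.iff_characterModule_injective] at hF
    exact (Module.injective_iff_injective_object _ _).1 hF
  induction n generalizing M with
  | zero =>
    have := key h
    infer_instance
  | succ n ih =>
    obtain ⟨F, _, _, p, hF, hp, hK⟩ := h
    let S : ShortComplex (ModuleCat.{u} A) := ShortComplex.mk
      (ModuleCat.ofHom (CharacterModule.dual p))
      (ModuleCat.ofHom (CharacterModule.dual (LinearMap.ker p).subtype))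
      (by
        rw [← ModuleCat.ofHom_comp, ← CharacterModule.dual_comp, LinearMap.comp_ker_subtype,
          CharacterModule.dual_zero]
        rfl)
    have hS : S.ShortExact :=
      { exact := by
          rw [ShortComplex.ShortExact.moduleCat_exact_iff_function_exact]
          intro c
          constructor
          · intro hc
            obtain ⟨d, hd⟩ := RChar.exists_map_eq p hp (show RChar A F from c)
              (fun z hz => DFunLike.congr_fun hc ⟨z, hz⟩)
            exact ⟨d, hd⟩
          · rintro ⟨d, rfl⟩
            ext z
            change d (p z.1) = 0
            rw [show p z.1 = 0 from z.2, map_zero]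
        mono_f := (ModuleCat.mono_iff_injective _).2
          (CharacterModule.dual_injective_of_surjective _ hp)
        epi_g := (ModuleCat.epi_iff_surjective _).2
          (CharacterModule.dual_surjective_of_injective _ (Submodule.injective_subtype _)) }
    have := key hF
    refine hS.hasInjectiveDimensionLT_X₁ (n + 1) (ih hK) ?_
    change HasInjectiveDimensionLT (ModuleCat.of A (CharacterModule F)) (n + 1 + 1)
    infer_instance

/-- Evaluation into the double character module. -/
def evalChar (M : Type u) [AddCommGroup M] [Module A M] :
    M →ₗ[A] CharacterModule (CharacterModule M) where
  toFun m := AddMonoidHom.mk' (fun c : CharacterModule M => c m) (fun _ _ => rfl)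
  map_add' m m' := by ext c; exact map_add c m m'
  map_smul' _ _ := rfl

/-- Evaluation into the double character module is a pure monomorphism. -/
theorem exists_extension_of_evalChar {P : Type u} [AddCommGroup P] [Module A P]
    [Module.Free A P] [Module.Finite A P] {K : Submodule A P} (hK : K.FG) (f : K →ₗ[A] M)
    (g : P →ₗ[A] CharacterModule (CharacterModule M))
    (hg : ∀ k : K, g k = evalChar (A := A) M (f k)) : ∃ h : P →ₗ[A] M, ∀ k : K, h k = f k := by
  classical
  let b := Module.Free.chooseBasis A P
  obtain ⟨l, k, hk⟩ := Submodule.fg_iff_exists_fin_generating_family.1 hK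
  have hkK : ∀ i, k i ∈ K := fun i => hk ▸ Submodule.subset_span ⟨i, rfl⟩
  let T : (P →ₗ[A] M) →+ (Fin l → M) := AddMonoidHom.mk' (fun h i => h (k i)) (fun _ _ => rfl)
  -- Extending `f` means solving a finite linear system in `M`. A character `(d i)` vanishing on all
  -- solvable right-hand sides satisfies `∑ i, (k i)_j • d i = 0` for each `j`; applying `g` shows
  -- that it also vanishes on `(f (k i))`.
  have hmem : (fun i => f ⟨k i, hkK i⟩) ∈ T.range := by
    refine mem_of_addChar (fun c hc => ?_)
    let d : Fin l → CharacterModule M := fun i => c.comp (AddMonoidHom.single (fun _ => M) i)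
    have hd : ∀ v : Fin l → M, c v = ∑ i, d i (v i) := fun v => by
      conv_lhs => rw [← Finset.univ_sum_single v]
      rw [map_sum]
      rfl
    have h0 : ∀ j, ∑ i, b.repr (k i) j • d i = 0 := fun j => by
      ext m
      have := hc _ ⟨(b.coord j).smulRight m, rfl⟩
      rw [hd] at this
      exact (AddMonoidHom.finsetSum_apply _ _ _).trans this
    rw [hd]
    have h1 : ∀ i, d i (f ⟨k i, hkK i⟩) = ∑ j, g (b j) (b.repr (k i) j • d i) := fun i => by
      have h2 : d i (f ⟨k i, hkK i⟩) = g (k i) (d i) :=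
        (DFunLike.congr_fun (hg ⟨k i, hkK i⟩) (d i)).symm
      rw [h2]
      conv_lhs => rw [← b.sum_repr (k i), map_sum]
      simp only [map_smul]
      exact AddMonoidHom.finsetSum_apply _ _ _
    simp only [h1]
    rw [Finset.sum_comm]
    refine Finset.sum_eq_zero (fun j _ => ?_)
    rw [← map_sum, h0, map_zero]
  obtain ⟨h, hh⟩ := hmem
  refine ⟨h, fun x => ?_⟩
  have hle : K ≤ Submodule.map K.subtype (LinearMap.eqLocus (h ∘ₗ K.subtype) f) := by
    conv_lhs => rw [← hk]
    rw [Submodule.span_le]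
    rintro _ ⟨i, rfl⟩
    exact ⟨⟨k i, hkK i⟩, congrFun hh i, rfl⟩
  obtain ⟨y, hy, e⟩ := hle x.2
  obtain rfl : y = x := Subtype.ext e
  exact hy

end Commutative

/-! ### Projective and flat dimension of injective modules over a Noetherian ring -/

section Noetherian

variable {A : Type u} [CommRing A]

/-- In degree one, a class is represented by a map from a finitely generated submodule of a finite
free module, and purity of `F → F⁺⁺` extends that map. Higher degrees follow by dimension shifting,
as syzygies of finite modules over `A` are finite. -/
theorem ext_eq_zero_of_comp_evalChar [IsNoetherianRing A] (F : ModuleCat.{u} A) (k : ℕ)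
    (M : ModuleCat.{u} A) [Module.Finite A M] (e : Ext M F (k + 1))
    (he : e.comp (Ext.mk₀ (ModuleCat.ofHom (evalChar (A := A) F))) (add_zero (k + 1)) = 0) :
    e = 0 := by
  induction k generalizing M with
  | zero =>
    obtain ⟨P, _, _, _, _, p, hp⟩ := Module.exists_finite_presentation A M
    have hS := LinearMap.shortExact_shortComplexKer hp
    have : Projective (ModuleCat.of A P) :=
      (IsProjective.iff_projective (R := A) P).1 inferInstance
    obtain ⟨f, rfl⟩ := precomp_extClass_surjective_of_projective_X₂ F hS 0 e
    obtain ⟨f, rfl⟩ := (Ext.mk₀_bijective _ _).2 f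
    change (hS.extClass.comp (Ext.mk₀ f) (add_comm 1 0)).comp _ _ = 0 at he
    rw [Ext.comp_assoc _ _ _ _ (add_zero 0) (by simp), Ext.mk₀_comp_mk₀] at he
    obtain ⟨g, hg⟩ := Ext.contravariant_sequence_exact₁ hS _ _ _ he
    obtain ⟨g, rfl⟩ := (Ext.mk₀_bijective _ _).2 g
    rw [Ext.mk₀_comp_mk₀] at hg
    have hg := (Ext.mk₀_bijective _ _).1 hg
    obtain ⟨h, hh⟩ := exists_extension_of_evalChar (A := A) (M := F) (P := P)
      (K := LinearMap.ker p) (IsNoetherian.noetherian _) f.hom g.hom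
      (fun x => congrArg (fun t => t.hom x) hg)
    have hf : f = p.shortComplexKer.f ≫ ModuleCat.ofHom h := by
      ext x
      exact (hh x).symm
    rw [hf, ← Ext.mk₀_comp_mk₀]
    exact hS.extClass_comp_assoc (h := add_comm 1 0) _
  | succ k ih =>
    obtain ⟨P, _, _, _, _, p, hp⟩ := Module.exists_finite_presentation A M
    have hS := LinearMap.shortExact_shortComplexKer hp
    have : Projective (ModuleCat.of A P) :=
      (IsProjective.iff_projective (R := A) P).1 inferInstance
    obtain ⟨e, rfl⟩ := precomp_extClass_surjective_of_projective_X₂ F hS (k + 1) e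
    change (hS.extClass.comp e (add_comm 1 (k + 1))).comp _ _ = 0 at he
    rw [Ext.comp_assoc _ _ _ _ (add_zero _) (by lia)] at he
    obtain ⟨g, hg⟩ := Ext.contravariant_sequence_exact₁ hS _ _ _ he
    rw [Ext.eq_zero_of_projective g, Ext.comp_zero] at hg
    rw [ih _ e hg.symm, map_zero]

/-- Baer's criterion needs only `Ext¹(A/J, F) = 0`; the general degree is shifted down along an
embedding into an injective. -/
theorem hasInjectiveDimensionLT_of_forall_finite (F : ModuleCat.{u} A) (n : ℕ)
    (h : ∀ (M : ModuleCat.{u} A) [Module.Finite A M] (e : Ext M F (n + 1)), e = 0) :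
    HasInjectiveDimensionLT F (n + 1) := by
  induction n generalizing F with
  | zero =>
    suffices Injective F from inferInstance
    suffices Module.Injective A F from (Module.injective_iff_injective_object A F).1 this
    refine Module.Baer.injective (fun J g => ?_)
    have hS := LinearMap.shortExact_shortComplexKer (Submodule.mkQ_surjective J)
    let f : (LinearMap.ker J.mkQ) →ₗ[A] F := g ∘ₗ (LinearEquiv.ofEq _ _ J.ker_mkQ).toLinearMap
    have : Module.Finite A (ModuleCat.of A (A ⧸ J)) := inferInstanceAs (Module.Finite A (A ⧸ J))
    obtain ⟨g', hg'⟩ := Ext.contravariant_sequence_exact₁ hS _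
      (Ext.mk₀ (ModuleCat.ofHom f)) (add_comm 1 0) (h (ModuleCat.of A (A ⧸ J)) _)
    obtain ⟨g', rfl⟩ := (Ext.mk₀_bijective _ _).2 g'
    rw [Ext.mk₀_comp_mk₀] at hg'
    have hg' := (Ext.mk₀_bijective _ _).1 hg'
    refine ⟨g'.hom, fun x hx => ?_⟩
    exact congrArg (fun t => t.hom (⟨x, by rwa [Submodule.ker_mkQ]⟩ : LinearMap.ker J.mkQ)) hg'
  | succ n ih =>
    obtain ⟨p⟩ := EnoughInjectives.presentation F
    have hS : (ShortComplex.mk _ _ (cokernel.condition p.f)).ShortExact :=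
      { exact := ShortComplex.exact_cokernel p.f }
    refine (hS.hasInjectiveDimensionLT_X₃_iff n p.injective).1 (ih _ (fun M _ e => ?_))
    obtain ⟨e', rfl⟩ := Ext.covariant_sequence_exact₃ M hS e rfl (h M _)
    have := p.injective
    rw [Ext.eq_zero_of_injective e', Ext.zero_comp]

/-- The flat modules over a Noetherian ring have injective dimension at most `n` if the injective
modules have flat dimension at most `n`. -/
theorem hasInjectiveDimensionLT_of_isFlat [IsNoetherianRing A] {n : ℕ} (hA : sfli A ≤ n)
    {F : ModuleCat.{u} A} (hF : IsFlat A F) : HasInjectiveDimensionLT F (n + 1) := by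
  refine hasInjectiveDimensionLT_of_forall_finite F n (fun M _ e => ?_)
  refine ext_eq_zero_of_comp_evalChar F n M e ?_
  -- `F⁺` is injective, so its flat dimension is at most `n`, and `F⁺⁺` has injective dimension at
  -- most `n`.
  rw [isFlat_iff_flat, Module.Flat.iff_characterModule_injective] at hF
  have := hasInjectiveDimensionLT_characterModule n (sfli_le_iff.1 hA _ hF)
  exact Ext.eq_zero_of_hasInjectiveDimensionLT _ (n + 1) le_rfl

/-- Flat coefficients suffice because the syzygies of a flat module are flat: in the last step,
vanishing of `Ext¹` into the kernel splits the projective cover. -/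
theorem hasProjectiveDimensionLT_of_isFlat_of_ext (j : ℕ) {M : Type u} [AddCommGroup M]
    [Module A M] (hM : IsFlat A M)
    (h : ∀ (X : ModuleCat.{u} A), IsFlat A X → ∀ e : Ext (ModuleCat.of A M) X (j + 1), e = 0) :
    HasProjectiveDimensionLT (ModuleCat.of A M) (j + 1) := by
  induction j generalizing M with
  | zero =>
    obtain ⟨P, _, _, p, hPf, hP, hp⟩ := exists_projective_cover A M
    have hS := LinearMap.shortExact_shortComplexKer hp
    suffices Projective (ModuleCat.of A M) from inferInstance
    obtain ⟨s, hs⟩ := Ext.covariant_sequence_exact₃ _ hS (Ext.mk₀ (𝟙 (ModuleCat.of A M)))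
      (zero_add 1) (h (ModuleCat.of A (LinearMap.ker p)) (hPf.ker hM p hp) _)
    obtain ⟨s, rfl⟩ := (Ext.mk₀_bijective _ _).2 s
    rw [Ext.mk₀_comp_mk₀] at hs
    have r : Retract (ModuleCat.of A M) (ModuleCat.of A P) :=
      ⟨s, _, (Ext.mk₀_bijective _ _).1 hs⟩
    exact r.projective
  | succ j ih =>
    obtain ⟨P, _, _, p, hPf, hP, hp⟩ := exists_projective_cover A M
    have hS := LinearMap.shortExact_shortComplexKer hp
    refine (hS.hasProjectiveDimensionLT_X₃_iff j hP).2 (ih (hPf.ker hM p hp) (fun X hX e => ?_))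
    obtain ⟨e', rfl⟩ := Ext.contravariant_sequence_exact₁ hS X e (add_comm 1 (j + 1)) (h X hX _)
    rw [Ext.eq_zero_of_projective e', Ext.comp_zero]

theorem hasProjectiveDimensionLT_of_isFlat [IsNoetherianRing A] {n : ℕ} (hA : sfli A ≤ n)
    {M : Type u} [AddCommGroup M] [Module A M] (hM : IsFlat A M) :
    HasProjectiveDimensionLT (ModuleCat.of A M) (n + 1) :=
  hasProjectiveDimensionLT_of_isFlat_of_ext n hM (fun X hX e => by
    have := hasInjectiveDimensionLT_of_isFlat hA hX
    exact e.eq_zero_of_hasInjectiveDimensionLT (n + 1) le_rfl)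

/-- Only finiteness of this crude bound matters; `hasProjectiveDimensionLT_of_sfli_le` improves it
to `n`. -/
theorem hasProjectiveDimensionLT_of_flatDimLE [IsNoetherianRing A] {n : ℕ} (hA : sfli A ≤ n)
    (m : ℕ) {M : Type u} [AddCommGroup M] [Module A M] (hM : FlatDimLE A m M) :
    HasProjectiveDimensionLT (ModuleCat.of A M) (n + m + 1) := by
  induction m generalizing M with
  | zero => exact hasProjectiveDimensionLT_of_isFlat hA hM
  | succ m ih =>
    obtain ⟨F, _, _, p, hF, hp, hK⟩ := hM
    have hS := LinearMap.shortExact_shortComplexKer hp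
    refine hS.hasProjectiveDimensionLT_X₃ (n + m + 1) (ih hK) ?_
    have := hasProjectiveDimensionLT_of_isFlat hA hF
    exact hasProjectiveDimensionLT_of_ge (ModuleCat.of A F) (n + 1) _ (by lia)

/-- A finite projective dimension is bounded by the injective dimensions of the free modules. -/
theorem hasProjectiveDimensionLT_of_sfli_le [IsNoetherianRing A] {n : ℕ} (hA : sfli A ≤ n)
    (M : ModuleCat.{u} A) (m : ℕ) (h : HasProjectiveDimensionLT M (n + 1 + m)) :
    HasProjectiveDimensionLT M (n + 1) := by
  induction m with
  | zero => exact h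
  | succ m ih =>
    refine ih (hasProjectiveDimensionLT_of_enoughInjectives M _ (fun X => ⟨fun e e' => ?_⟩))
    suffices ∀ e : Ext M X (n + 1 + m), e = 0 by rw [this e, this e']
    clear e e'
    intro e
    -- In the top degree, `Ext(M, P) → Ext(M, X)` is onto, and its source vanishes because the flat
    -- module `P` has injective dimension at most `n`.
    obtain ⟨P, _, _, p, hP, -, hp⟩ := exists_projective_cover A X
    have hS := LinearMap.shortExact_shortComplexKer hp
    obtain ⟨e', rfl⟩ := Ext.covariant_sequence_exact₃ M hS e rfl
      (Ext.eq_zero_of_hasProjectiveDimensionLT _ (n + 1 + (m + 1)) le_rfl)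
    have : HasInjectiveDimensionLT (ModuleCat.of A P) (n + 1) :=
      hasInjectiveDimensionLT_of_isFlat hA hP
    rw [Ext.eq_zero_of_hasInjectiveDimensionLT e' (n + 1) (by lia), Ext.zero_comp]

theorem spli_le_of_sfli_le [IsNoetherianRing A] {n : ℕ} (hA : sfli A ≤ n) : spli A ≤ n :=
  spli_le_iff.2 (fun E _ _ hE => hasProjectiveDimensionLT_of_sfli_le hA _ n (by
    have := hasProjectiveDimensionLT_of_flatDimLE hA n (sfli_le_iff.1 hA E hE)
    rwa [add_right_comm] at this))

end Noetherian

/-! ### Group algebras of infinite cyclic groups -/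

section Augmentation

variable {A : Type u} [CommRing A] {B : Type u} [CommRing B] [Algebra A B] (ε : B →ₐ[A] A)
  {x : B}

theorem smul_eq_algebraMap_smul {I : Ideal B} (hI : ∀ b, b - algebraMap A B (ε b) ∈ I)
    {M : Type u} [AddCommGroup M] [Module B M] (hM : Killed B I M) (b : B) (m : M) :
    b • m = algebraMap A B (ε b) • m := by
  rw [← sub_eq_zero, ← sub_smul]
  exact hM _ (hI b) m

/-- Restriction along `ε` makes `A`-modules into `B`-modules killed by `I`, and `B` acts on `M`
through `ε`. So injectivity of characters relative to `I` becomes injectivity over `A`. -/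
theorem RFlat.isFlat_of_augmentation {I : Ideal B} (hε : ∀ b ∈ I, ε b = 0)
    (hI : ∀ b, b - algebraMap A B (ε b) ∈ I)
    {M : Type u} [AddCommGroup M] [Module B M] (hM : RFlat B I M)
    {J : Type u} [AddCommGroup J] [Module A J] (e : J ≃+ M)
    (he : ∀ a j, e (a • j) = algebraMap A B a • e j) : IsFlat A J := by
  rw [isFlat_iff_injective_rChar]
  refine ⟨fun X X' _ _ _ _ i hi g => ?_⟩
  let φ : Bᵐᵒᵖ →+* Aᵐᵒᵖ := RingHom.op ε.toRingHom
  let _ : Module Bᵐᵒᵖ X := Module.compHom X φ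
  let _ : Module Bᵐᵒᵖ X' := Module.compHom X' φ
  have key : ∀ (Y : Type u) [AddCommGroup Y] [Module Aᵐᵒᵖ Y],
      @Killed B _ Bᵐᵒᵖ _ _ I Y _ (Module.compHom Y φ) := fun Y _ _ b hb y => by
    change MulOpposite.op (ε b) • y = 0
    rw [hε b hb, MulOpposite.op_zero, zero_smul]
  let i' : X →ₗ[Bᵐᵒᵖ] X' := ⟨i.toAddHom, fun b y => i.map_smul (φ b) y⟩
  let g' : X →ₗ[Bᵐᵒᵖ] RChar B M :=
    { toFun := fun y => AddMonoidHom.comp (show J →+ AddCircle (1 : ℚ) from g y)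
        e.symm.toAddMonoidHom
      map_add' := fun y z => by
        ext m
        exact DFunLike.congr_fun (g.map_add y z) (e.symm m)
      map_smul' := fun b y => by
        ext m
        refine (DFunLike.congr_fun (g.map_smul (φ b) y) (e.symm m)).trans ?_
        refine (RChar.smul_apply _ _ _).trans ?_
        change g y (ε b.unop • e.symm m) = g y (e.symm (b.unop • m))
        congr 1
        apply e.injective
        rw [he, e.apply_symm_apply, e.apply_symm_apply, ← smul_eq_algebraMap_smul ε hI hM.1] }
  obtain ⟨k, hk⟩ := hM.2 X X' i' hi (key X) (key X') g'
  refine ⟨{ toFun := fun y => AddMonoidHom.comp (show M →+ AddCircle (1 : ℚ) from k y)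
              e.toAddMonoidHom
            map_add' := fun y z => by
              ext j
              exact DFunLike.congr_fun (k.map_add y z) (e j)
            map_smul' := fun a y => by
              have ha : a • y = MulOpposite.op (algebraMap A B a.unop) • y := by
                change a • y = MulOpposite.op (ε (algebraMap A B a.unop)) • y
                rw [ε.commutes]
                rfl
              ext j
              change k (a • y) (e j) = k y (e (a.unop • j))
              rw [ha, k.map_smul, he]
              rfl }, fun y => ?_⟩
  ext j
  refine (DFunLike.congr_fun (hk y) (e j)).trans ?_
  change g y (e.symm (e j)) = g y j
  rw [e.symm_apply_apply]

theorem flatDimLE_of_res_augmentation {I : Ideal B} {S : Submonoid B} (hε : ∀ b ∈ I, ε b = 0)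
    (hI : ∀ b, b - algebraMap A B (ε b) ∈ I) (n : ℕ)
    {M : Type u} [AddCommGroup M] [Module B M] (hM : Res (LFlat B I S) (LFlat B I S) n M)
    {J : Type u} [AddCommGroup J] [Module A J] (e : J ≃+ M)
    (he : ∀ a j, e (a • j) = algebraMap A B a • e j) : FlatDimLE A n J := by
  induction n generalizing M J with
  | zero => exact hM.1.isFlat_of_augmentation ε hε hI e he
  | succ n ih =>
    obtain ⟨F, _, _, p, hF, hp, hK⟩ := hM
    let _ : Module A F := Module.compHom F (algebraMap A B)
    let p' : F →ₗ[A] J :=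
      { toFun := fun f => e.symm (p f)
        map_add' := fun f f' => by rw [map_add, map_add]
        map_smul' := fun a f => by
          apply e.injective
          rw [RingHom.id_apply, he, e.apply_symm_apply, e.apply_symm_apply]
          exact p.map_smul (algebraMap A B a) f }
    have hmem : ∀ f, f ∈ LinearMap.ker p' ↔ f ∈ LinearMap.ker p := fun f => by
      rw [LinearMap.mem_ker, LinearMap.mem_ker]
      exact e.symm.map_eq_zero_iff
    refine ⟨F, _, _, p', hF.1.isFlat_of_augmentation ε hε hI (AddEquiv.refl F) (fun _ _ => rfl),
      e.symm.surjective.comp hp, ih hK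
        { toFun := fun f => ⟨f.1, (hmem _).1 f.2⟩
          invFun := fun f => ⟨f.1, (hmem _).2 f.2⟩
          left_inv := fun _ => rfl
          right_inv := fun _ => rfl
          map_add' := fun _ _ => rfl } (fun _ _ => rfl)⟩

/-- Passing to the quotient by a nonzerodivisor lowers the flat dimensions of the injective
modules. -/
theorem sfli_le_of_augmentation (hx : ∀ b, x * b = 0 → b = 0) (hεx : ε x = 0)
    (hI : ∀ b, b - algebraMap A B (ε b) ∈ Ideal.span {x}) {n : ℕ} (hB : sfli B ≤ (n + 1 : ℕ)) :
    sfli A ≤ n := by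
  refine sfli_le_iff.2 (fun J _ _ hJ => ?_)
  let E := Coind (A := A) B J
  have hE : Module.Injective B E := Coind.injective hJ
  have hloc : ∀ (M : Type u) [AddCommGroup M] [Module B M], SLoc B (⊥ : Submonoid B) M := by
    rintro M _ _ s hs
    obtain rfl := Submonoid.mem_bot.1 hs
    simp only [map_one, one_smul]
    exact Function.bijective_id
  have hflat : ∀ (M : Type u) [AddCommGroup M] [Module B M], IsFlat B M →
      LFlat B (⊥ : Ideal B) (⊥ : Submonoid B) M := fun M _ _ h =>
    ⟨isFlat_iff_rFlat_bot.1 h, hloc M⟩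
  have h₁ := ((flatDimLE_iff_res _ _).1 (sfli_le_iff.1 hB E hE)).imp hflat hflat
  have hreg : RegularMod B (⊥ : Ideal B) (⊥ : Submonoid B) x := by
    rw [regularMod_self_iff]
    intro b hb
    exact ⟨1, one_mem _, by rw [one_mul]; exact hx b hb⟩
  have h₂ := res_ker_cmul hreg (rInj_bot_iff.2 hE) killed_bot (hloc E) n h₁
  rw [bot_sup_eq] at h₂
  have hε : ∀ b ∈ Ideal.span {x}, ε b = 0 := fun b hb => by
    obtain ⟨c, rfl⟩ := Ideal.mem_span_singleton'.1 hb
    rw [map_mul, hεx, mul_zero]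
  -- An `x`-torsion element of the coinduced module vanishes on `(x)`, so it is determined by its
  -- value at `1`. This identifies the torsion with `J`.
  have hker : ∀ (f : LinearMap.ker (cmul B E x)) (b : B), f.1 b = ε b • f.1 1 := fun f b => by
    obtain ⟨c, hc⟩ := Ideal.mem_span_singleton'.1 (hI b)
    have h0 : f.1 (c * x) = 0 := DFunLike.congr_fun (show x • f.1 = 0 from f.2) c
    rw [hc, map_sub, sub_eq_zero] at h0
    rw [h0, Algebra.algebraMap_eq_smul_one]
    exact map_smul f.1 (ε b) 1
  let ι : J → E := fun j => LinearMap.smulRight ε.toLinearMap j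
  have hι : ∀ j b, ι j b = ε b • j := fun _ _ => rfl
  refine flatDimLE_of_res_augmentation ε hε hI n h₂
    { toFun := fun j => ⟨ι j, Coind.ext fun b => by
        change ι j (b * x) = 0
        rw [hι, map_mul, hεx, mul_zero, zero_smul]⟩
      invFun := fun f => f.1 1
      left_inv := fun j => by
        change ε 1 • j = j
        rw [map_one, one_smul]
      right_inv := fun f => Subtype.ext (Coind.ext fun b => (hker f b).symm)
      map_add' := fun j j' => Subtype.ext (Coind.ext fun b => smul_add _ _ _) }
    (fun a j => Subtype.ext (Coind.ext fun b => ?_))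
  refine Eq.trans ?_ (Coind.algebraMap_smul_apply a (ι j) b).symm
  change ε b • a • j = a • ε b • j
  exact smul_comm _ _ _

end Augmentation

section Cyclic

variable {A : Type u} [CommRing A] {G : Type u} [CommGroup G] [Infinite G] {g : G}

/-- The augmentation ideal is generated by `g - 1`, which is a nonzerodivisor because `G` is
infinite. -/
theorem sfli_le_of_infinite_cyclic (hg : Subgroup.zpowers g = ⊤) {n : ℕ}
    (hB : sfli (MonoidAlgebra A G) ≤ n) : sfli A ≤ n := by
  let x : MonoidAlgebra A G := MonoidAlgebra.single g 1 - 1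
  let ε : MonoidAlgebra A G →ₐ[A] A := MonoidAlgebra.lift A A G 1
  have hε : ∀ h a, ε (MonoidAlgebra.single h a) = a := fun h a => by
    simp [ε]
  have hx : ∀ h : G, (MonoidAlgebra.single h 1 - 1 : MonoidAlgebra A G) ∈ Ideal.span {x} := by
    intro h
    have hh : h ∈ Subgroup.closure {g} := by
      rw [← Subgroup.zpowers_eq_closure, hg]
      trivial
    induction hh using Subgroup.closure_induction with
    | mem t ht =>
      obtain rfl := ht
      exact Ideal.mem_span_singleton_self x
    | one =>
      rw [← MonoidAlgebra.one_def, sub_self]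
      exact zero_mem _
    | mul k l _ _ hk hl =>
      have : (MonoidAlgebra.single (k * l) 1 - 1 : MonoidAlgebra A G) =
          MonoidAlgebra.single k 1 * (MonoidAlgebra.single l 1 - 1) +
            (MonoidAlgebra.single k 1 - 1) := by
        rw [mul_sub, MonoidAlgebra.single_mul_single, mul_one, mul_one, sub_add_sub_cancel]
      rw [this]
      exact add_mem (Ideal.mul_mem_left _ _ hl) hk
    | inv k _ hk =>
      have : (MonoidAlgebra.single k⁻¹ 1 - 1 : MonoidAlgebra A G) =
          -MonoidAlgebra.single k⁻¹ 1 * (MonoidAlgebra.single k 1 - 1) := by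
        rw [mul_sub, neg_mul, MonoidAlgebra.single_mul_single, inv_mul_cancel, mul_one, mul_one,
          ← MonoidAlgebra.one_def]
        ring
      rw [this]
      exact Ideal.mul_mem_left _ _ hk
  have : Infinite (⊤ : Subgroup G) := Infinite.of_injective _ Subgroup.topEquiv.symm.injective
  refine sfli_le_of_augmentation (x := x) ε (fun b hb => ?_) ?_ (fun b => ?_)
    -- The degree gained by `sfli_le_of_augmentation` is given up, which makes `n = 0`
    -- unexceptional.
    (hB.trans (by exact_mod_cast n.le_succ))
  · have := coeff_mem_of_invariant (I := (⊥ : Ideal A)) (H := (⊤ : Subgroup G)) (T := {g})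
      (by rw [← Subgroup.zpowers_eq_closure, hg]) (b := b) (by
        rintro _ rfl
        rw [hb]
        exact zero_mem _)
    simpa using this
  · rw [map_sub, hε, map_one, sub_self]
  · rw [← MonoidAlgebra.sum_coeff_single b, Finsupp.sum, map_sum, map_sum,
      ← Finset.sum_sub_distrib]
    refine sum_mem (fun h _ => ?_)
    have : (MonoidAlgebra.single h (b.coeff h) - algebraMap A (MonoidAlgebra A G)
        (ε (MonoidAlgebra.single h (b.coeff h)))) =
        algebraMap A (MonoidAlgebra A G) (b.coeff h) * (MonoidAlgebra.single h 1 - 1) := by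
      rw [hε, mul_sub, mul_one, ← Algebra.smul_def, MonoidAlgebra.smul_single, smul_eq_mul, mul_one]
    rw [this]
    exact Ideal.mul_mem_left _ _ (hx h)

end Cyclic

/-! ### The principles over a Noetherian ring -/

section Principles

variable {A : Type u} [CommRing A]

theorem zpowers_int : Subgroup.zpowers (ULift.up.{u} (Multiplicative.ofAdd (1 : ℤ))) = ⊤ := by
  rw [eq_top_iff]
  rintro ⟨k⟩ -
  refine ⟨k.toAdd, ULift.down_injective ?_⟩
  change (Multiplicative.ofAdd (1 : ℤ)) ^ k.toAdd = k
  rw [← ofAdd_zsmul]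
  simp

theorem not_isLocallyFinite_int : ¬ IsLocallyFinite (ULift.{u} (Multiplicative ℤ)) := fun h => by
  have hfg : (⊤ : Subgroup (ULift.{u} (Multiplicative ℤ))).FG := by
    refine ⟨{ULift.up (Multiplicative.ofAdd 1)}, ?_⟩
    rw [Finset.coe_singleton, ← Subgroup.zpowers_eq_closure, zpowers_int]
  have := h ⊤ hfg
  have : Infinite (⊤ : Subgroup (ULift.{u} (Multiplicative ℤ))) :=
    Infinite.of_injective _ Subgroup.topEquiv.symm.injective
  exact not_finite (⊤ : Subgroup (ULift.{u} (Multiplicative ℤ)))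

theorem sfli_eq_top_of_int (h : sfli A = ⊤) :
    sfli (MonoidAlgebra A (ULift.{u} (Multiplicative ℤ))) = ⊤ := by
  by_contra hne
  obtain ⟨n, hn⟩ := ENat.ne_top_iff_exists.1 hne
  have := sfli_le_of_infinite_cyclic (A := A) zpowers_int hn.symm.le
  rw [h] at this
  exact absurd (top_le_iff.1 this) (ENat.natCast_ne_top n)

theorem spli_eq_top_of_sfli_eq_top {R : Type u} [Ring R] (h : sfli R = ⊤) : spli R = ⊤ := by
  by_contra hne
  obtain ⟨n, hn⟩ : ∃ n : ℕ, spli R ≤ n := by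
    cases hs : spli R with
    -- The value `⊥` does occur, for instance over the zero ring.
    | bot => exact ⟨0, bot_le⟩
    | coe m =>
      rw [hs] at hne
      obtain ⟨n, rfl⟩ := ENat.ne_top_iff_exists.1 (fun h : m = ⊤ => hne (by rw [h]; rfl))
      exact ⟨n, le_rfl⟩
  have := sfli_le_of_spli_le hn
  rw [h] at this
  exact absurd (top_le_iff.1 this) (ENat.natCast_ne_top n)

theorem sfli_of_subsingleton {R : Type u} [Ring R] [Subsingleton R] : sfli R = 0 := by
  refine le_antisymm ?_ (zero_le)
  refine (sfli_le_iff (n := 0)).2 (fun E _ _ _ => ?_)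
  have := Module.subsingleton R E
  exact IsFlat.of_projective inferInstance

theorem spli_of_subsingleton {R : Type u} [Ring R] [Subsingleton R] : spli R = ⊥ := by
  refine le_bot_iff.1 (iSup₂_le (fun E _ => ?_))
  have := Module.subsingleton R E
  rw [(CategoryTheory.projectiveDimension_eq_bot_iff E).2 (ModuleCat.isZero_of_subsingleton E)]

theorem exists_flatDimLE_not {n : ℕ} (h : sfli A = n) (hn : n ≠ 0) :
    ∃ (M : Type u) (_ : AddCommGroup M) (_ : Module A M),
      FlatDimLE A n M ∧ ¬ FlatDimLE A (n - 1) M := by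
  by_contra! hno
  have : sfli A ≤ (n - 1 : ℕ) := sfli_le_iff.2 (fun E _ _ hE =>
    hno E _ _ (sfli_le_iff.1 h.le E hE))
  rw [h] at this
  have : n ≤ n - 1 := by exact_mod_cast this
  omega

theorem isLocallyFinite_of_sfli_le [IsNoetherianRing A] [Nontrivial A] {G : Type u} [Group G]
    {n : ℕ} (h : sfli A = n) (hG : sfli (MonoidAlgebra A G) ≤ n) : IsLocallyFinite G :=
  isLocallyFinite_of_flatDimLE n (exists_flatDimLE_not h) (sfli_le_iff.1 hG)

/-- If `spli` or `sfli` distinguishes `A` from its group algebra over `ℤ`, then `A` is nontrivial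
and its injective modules have bounded flat dimension. -/
theorem nontrivial_and_exists_sfli_eq
    (h : sfli (MonoidAlgebra A (ULift.{u} (Multiplicative ℤ))) ≠ sfli A ∨
      spli (MonoidAlgebra A (ULift.{u} (Multiplicative ℤ))) ≠ spli A) :
    Nontrivial A ∧ ∃ n : ℕ, sfli A = n := by
  constructor
  · by_contra hA
    rw [not_nontrivial_iff_subsingleton] at hA
    have : Subsingleton (MonoidAlgebra A (ULift.{u} (Multiplicative ℤ))) :=
      MonoidAlgebra.coeff_injective.subsingleton
    simp [sfli_of_subsingleton, spli_of_subsingleton] at h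
  · by_contra hA
    have hA : sfli A = ⊤ := by
      by_contra hne
      obtain ⟨n, hn⟩ := ENat.ne_top_iff_exists.1 hne
      exact hA ⟨n, hn.symm⟩
    have hZ := sfli_eq_top_of_int hA
    simp [hA, hZ, spli_eq_top_of_sfli_eq_top] at h

end Principles

end GroupAlgebraDim

theorem proposition3p18 (A : Type u) [CommRing A] [IsNoetherianRing A] :
    (GroupAlgebraDim.SpliFinitePrinciple A → GroupAlgebraDim.SfliLocallyFinitePrinciple A) ∧
      (GroupAlgebraDim.SfliLocallyFinitePrinciple A →
        GroupAlgebraDim.SpliLocallyFinitePrinciple A) := by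
  constructor
  · intro hA G _ hG
    obtain ⟨_, n, hn⟩ := GroupAlgebraDim.nontrivial_and_exists_sfli_eq (A := A)
      -- `ℤ` is infinite, so the principle excludes equality of `spli` for `A` and `Aℤ`.
      (Or.inr (fun h => not_finite_iff_infinite.2 inferInstance (hA _ h)))
    exact GroupAlgebraDim.isLocallyFinite_of_sfli_le hn (hG.trans hn).le
  · intro hA G _ hG
    obtain ⟨_, n, hn⟩ := GroupAlgebraDim.nontrivial_and_exists_sfli_eq (A := A)
      (Or.inl (fun h => GroupAlgebraDim.not_isLocallyFinite_int (hA _ h)))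
    exact GroupAlgebraDim.isLocallyFinite_of_sfli_le hn
      -- `sfli (AG) ≤ n` holds because `spli (AG) = spli A ≤ n`, the last bound using that `A` is
      -- Noetherian.
      (GroupAlgebraDim.sfli_le_of_spli_le (hG.le.trans (GroupAlgebraDim.spli_le_of_sfli_le hn.le)))
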